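/- Let $\lambda>0$, $\mathbb R_+=(0,\infty)$, $d\mu(x)=x^{2\lambda}\,dx$. Throughout, $B$ ranges over the bounded open intervals $B=(a,b)$ with $0\le a<b<\infty$, functions are real-valued and measurable on $\mathbb R_+$, and $w(E)=\int_E w\,dx$. A non-negative measurable function $w$ on $\mathbb R_+$, not a.e. zero, belongs to $\widetilde A_{p,\lambda-1/2}$, $1<p<\infty$, if (with $p'=p/(p-1)$) $$\sup_{B}\Big(\frac1{\mu(B)}\int_B w\,dt\Big)\Big(\frac1{\mu(B)}\int_B t^{2\lambda p'}w(t)^{-1/(p-1)}dt\Big)^{p-1}<\infty ,$$ and to $\widetilde A_{1,\lambda-1/2}$ if there is $C$ such that for all $B$, $w(B)/\mu(B)\le C\,w(x)\,x^{-2\lambda}$ for a.e. $x\in B$; put $\widetilde A_{\infty,\lambda-1/2}=\bigcup_{p\ge1}\widetilde A_{p,\lambda-1/2}$. For $1\le p<\infty$ let $\mathrm{BMO}_{L^p(w)}(\mathbb R_+)$ be the set of $f\in L^1_{loc}(\mathbb R_+,w\,dx)$, $\mu$-integrable on every $B$, with $$\|f\|_{\mathrm{BMO}_{L^p(w)}}=\sup_B\Big(\frac1{w(B)}\int_B|f-f_B|^p\,w\,dt\Big)^{1/p}<\infty,\qquad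 f_B=\frac1{\mu(B)}\int_B f\,d\mu .$$ Let $\mathrm{BMO}_{\Delta_\lambda}(\mathbb R_+)$ be the space of $f$, $\mu$-integrable on every $B$, with $\sup_B\frac1{\mu(B)}\int_B|f-f_B|\,d\mu<\infty$; let $\mathrm{BMO}_{L^p(dx)}(\mathbb R_+)$ be the space of $f$, Lebesgue integrable on every $B$, with $\sup_B\big(\frac1{|B|}\int_B|f-\frac1{|B|}\int_B f\,dy|^p\,dt\big)^{1/p}<\infty$, and $\mathrm{BMO}(\mathbb R_+)=\mathrm{BMO}_{L^1(dx)}(\mathbb R_+)$. For $0<s\le\frac12$ let $\mathrm{BMO}_{0,s}(\mathbb R_+,w)$ be the space of measurable $f$ with $$\|f\|_{\mathrm{BMO}_{0,s}(\mathbb R_+,w)}=\sup_B\inf_{c\in\mathbb R}\inf\{t\ge0:\ w(\{x\in B:|f(x)-c|>t\})<s\,w(B)\}<\infty ,$$ and $\mathrm{BMO}_{0,s}(\mathbb R_+)$ the case $w\equiv1$. **Theorem.** Let $\lambda>0$, $w\in\widetilde A_{\infty,\lambda-1/2}$, $0<s\le\frac12$ and $1\le p<\infty$. Then $$\mathrm{BMO}_{0,s}(\mathbb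 R_+,w)\simeq\mathrm{BMO}_{L^p(w)}(\mathbb R_+)\simeq\mathrm{BMO}_{\Delta_\lambda}(\mathbb R_+)\simeq\mathrm{BMO}(\mathbb R_+)\simeq\mathrm{BMO}_{L^p(dx)}(\mathbb R_+)\simeq\mathrm{BMO}_{0,s}(\mathbb R_+),$$ where $X\simeq Y$ means that $X$ and $Y$ contain the same functions and that, for a finite constant $C$ independent of $f$, $\|f\|_X\le C\|f\|_Y$ and $\|f\|_Y\le C\|f\|_X$ for all $f\in X$. The same spaces, up to $\simeq$, are obtained if the averages in $\mathrm{BMO}_{L^p(dx)}$ are taken with respect to $\mu$ instead of $dx$, and, for $0<s<\frac12$, if "$<s\,w(B)$" is replaced by "$\le s\,w(B)$" in the definition of $\mathrm{BMO}_{0,s}(\mathbb R_+,w)$ and of $\mathrm{BMO}_{0,s}(\mathbb R_+)$. -/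

import Mathlib

open MeasureTheory Set
open scoped ENNReal NNReal

namespace BesselBMO

/-- Lebesgue measure on the half-line `ℝ₊ = (0, ∞)`. -/
noncomputable def leb : Measure ℝ := volume.restrict (Ioi 0)

/-- The measure `w dx` on `ℝ₊`. -/
noncomputable def wdx (w : ℝ → ℝ) : Measure ℝ :=
  leb.withDensity (fun x => ENNReal.ofReal (w x))

/-- The Bessel measure `dμ(x) = x ^ (2 lam) dx` on `ℝ₊`. -/
noncomputable def besselMu (lam : ℝ) : Measure ℝ := wdx (fun x => x ^ (2 * lam))

/-- The measure `dν_lam(x) = x ^ (2 lam + 1) dx` on `ℝ₊`. -/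
noncomputable def nu (lam : ℝ) : Measure ℝ := wdx (fun x => x ^ (2 * lam + 1))

/-- A non-negative Lebesgue measurable function on `ℝ₊`. -/
def NonnegMeasurable (w : ℝ → ℝ) : Prop :=
  AEMeasurable w leb ∧ ∀ x, 0 < x → 0 ≤ w x

/-- The class `Ã_{1,lam}`. -/
def MemTildeAOne (lam : ℝ) (w : ℝ → ℝ) : Prop :=
  NonnegMeasurable w ∧ ∃ C : ℝ≥0, ∀ a b : ℝ, 0 ≤ a → a < b →
    ∀ᵐ x ∂(leb.restrict (Ioo a b)),
      wdx w (Ioo a b) / nu lam (Ioo a b) ≤ C * ENNReal.ofReal (w x / x ^ (2 * lam + 1))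

/-- The class `Ã_{p,lam}` for `1 < p < ∞`; the powers of `w` are taken in `[0, ∞]`, so that
`0` raised to a negative power is `∞`. -/
def MemTildeA (lam p : ℝ) (w : ℝ → ℝ) : Prop :=
  NonnegMeasurable w ∧ ∃ C : ℝ≥0, ∀ a b : ℝ, 0 ≤ a → a < b →
    ((nu lam (Ioo a b))⁻¹ * ∫⁻ t in Ioo a b, ENNReal.ofReal (w t) ∂leb) *
      ((nu lam (Ioo a b))⁻¹ * ∫⁻ t in Ioo a b,
        ENNReal.ofReal (t ^ ((2 * lam + 1) * (p / (p - 1)))) *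
          ENNReal.ofReal (w t) ^ (-(1 / (p - 1))) ∂leb) ^ (p - 1) < C

/-- The class `Ã_{∞,lam}`, the union of all `Ã_{p,lam}` with `1 ≤ p < ∞`. -/
def MemTildeAInfty (lam : ℝ) (w : ℝ → ℝ) : Prop :=
  MemTildeAOne lam w ∨ ∃ p : ℝ, 1 < p ∧ MemTildeA lam p w

/-- A set of functions on `ℝ₊` (values off `ℝ₊` are irrelevant) with a gauge. -/
structure GaugeSpace where
  carrier : Set (ℝ → ℝ)
  gauge : (ℝ → ℝ) → ℝ≥0∞

/-- Two spaces have the same elements, and their gauges are equivalent on them. -/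
def GaugeSpace.Equivalent (X Y : GaugeSpace) : Prop :=
  X.carrier = Y.carrier ∧ ∃ C : ℝ≥0, ∀ f ∈ X.carrier,
    X.gauge f ≤ C * Y.gauge f ∧ Y.gauge f ≤ C * X.gauge f

/-- The supremum, over all bounded open intervals `B ⊆ ℝ₊`, of the `L^p` mean with respect to
`κ` on `B` of `f - f_B`, where `f_B` is the average of `f` over `B` with respect to `m`. -/
noncomputable def meanOscGauge (m κ : Measure ℝ) (p : ℝ) (f : ℝ → ℝ) : ℝ≥0∞ :=
  ⨆ (a : ℝ) (b : ℝ) (_ : 0 ≤ a) (_ : a < b),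
    ((κ (Ioo a b))⁻¹ * ∫⁻ t in Ioo a b, ‖f t - ⨍ y in Ioo a b, f y ∂m‖ₑ ^ p ∂κ) ^ (1 / p)

/-- The functions of bounded `p`-mean oscillation with respect to `κ`, with averages taken with
respect to `m`. They are locally integrable with respect to `κ` and have a well-defined average
with respect to `m` over every bounded interval. -/
noncomputable def meanOscSpace (m κ : Measure ℝ) (p : ℝ) : GaugeSpace where
  carrier := {f | AEMeasurable f leb ∧ LocallyIntegrableOn f (Ioi 0) κ ∧
    (∀ a b : ℝ, 0 ≤ a → a < b → IntegrableOn f (Ioo a b) m) ∧ meanOscGauge m κ p f < ∞}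
  gauge := meanOscGauge m κ p

/-- `BMO_{L^p(w)}(ℝ₊)`: averages with respect to `μ`, oscillation with respect to `w dx`. -/
noncomputable def bmoLp (lam : ℝ) (w : ℝ → ℝ) (p : ℝ) : GaugeSpace :=
  meanOscSpace (besselMu lam) (wdx w) p

/-- `BMO_{Δ_lam}(ℝ₊)`. -/
noncomputable def bmoDelta (lam : ℝ) : GaugeSpace :=
  meanOscSpace (besselMu lam) (besselMu lam) 1

/-- The classical space `BMO(ℝ₊)`. -/
noncomputable def bmoClassical : GaugeSpace := meanOscSpace leb leb 1

/-- The classical space `BMO_{L^p(dx)}(ℝ₊)`, with Lebesgue averages. -/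
noncomputable def bmoLpClassical (p : ℝ) : GaugeSpace := meanOscSpace leb leb p

/-- The supremum over all bounded open intervals `B ⊆ ℝ₊` of the infimum over `c` of
`inf {t ≥ 0 : w {x ∈ B : |f x - c| > t} < s * w B}`. -/
noncomputable def medianGauge (s : ℝ) (w : ℝ → ℝ) (f : ℝ → ℝ) : ℝ≥0∞ :=
  ⨆ (a : ℝ) (b : ℝ) (_ : 0 ≤ a) (_ : a < b), ⨅ (c : ℝ) (t : ℝ≥0)
    (_ : wdx w {x | x ∈ Ioo a b ∧ (t : ℝ) < |f x - c|} < ENNReal.ofReal s * wdx w (Ioo a b)),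
    (t : ℝ≥0∞)

/-- The same quantity with the non-strict inequality `w {x ∈ B : |f x - c| > t} ≤ s * w B`. -/
noncomputable def medianGaugeLe (s : ℝ) (w : ℝ → ℝ) (f : ℝ → ℝ) : ℝ≥0∞ :=
  ⨆ (a : ℝ) (b : ℝ) (_ : 0 ≤ a) (_ : a < b), ⨅ (c : ℝ) (t : ℝ≥0)
    (_ : wdx w {x | x ∈ Ioo a b ∧ (t : ℝ) < |f x - c|} ≤ ENNReal.ofReal s * wdx w (Ioo a b)),
    (t : ℝ≥0∞)

/-- `BMO_{0,s}(ℝ₊, w)`. -/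
noncomputable def bmoZero (s : ℝ) (w : ℝ → ℝ) : GaugeSpace where
  carrier := {f | AEMeasurable f leb ∧ medianGauge s w f < ∞}
  gauge := medianGauge s w

/-- The variant of `BMO_{0,s}(ℝ₊, w)` with the non-strict inequality. -/
noncomputable def bmoZeroLe (s : ℝ) (w : ℝ → ℝ) : GaugeSpace where
  carrier := {f | AEMeasurable f leb ∧ medianGaugeLe s w f < ∞}
  gauge := medianGaugeLe s w

end BesselBMO

/-!
All the spaces are compared with a single gauge, the median gauge at level `1 / 2` with respect to
the Bessel measure `μ`. Every measure that occurs, `w dx`, `μ` and `dx`, is `Admissible`: absolutely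
continuous, with positive finite mass on bounded intervals.

The heart of the matter is a John–Nirenberg inequality which holds for every admissible measure `κ`,
without doubling, and under the weakest hypothesis, `MedianBounded κ f A`: on each interval, `f` is
within `A` of some constant on more than half of the mass. Let `E = {f > l}` fill at most half of
an interval `B`. By continuity of the mass, almost every point of `E` lies in a subinterval `J` of
which `E` fills exactly half, and finitely many of these, overlapping at most twice, cover `E` up to
a small remainder (`exists_half_cover`). The constant of such a `J` must lie within `A` of `l`,
because the good part of `J` meets both `E` and its complement; so `{l - 2 A < f ≤ l + 2 A}`
fills more than half of `J`. Summing over `J`, this set has at least a quarter of the mass of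
`E`, whence `κ {f > l + 2 A} ≤ (4 / 5) κ {f > l - 2 A}` in `B` (`MedianBounded.real_lt_add_le`).
Iteration gives exponential decay, and so bounds for all `L^p` means (`exists_lintegral_rpow_le`).

To pass between two measures it suffices that sets with half of the `m`-mass of an interval carry a
fixed proportion of its `κ`-mass (`HalfComparable`). For `w dx` against `μ` this follows from the
`A_p` condition by Hölder's inequality, for `μ` against `dx` from the explicit density. The
same coverings by half-filled intervals show that this relation is symmetric
(`HalfComparable.symm`), a form of the equivalence of the `A_∞` conditions.

Finally, Chebyshev's inequality bounds the median gauge at any level by a mean oscillation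
(`medianGauge_le_mul_meanOscGauge`), the exponential decay bounds mean oscillations by the median
gauge at level `1 / 2` (`HalfComparable.exists_meanOscGauge_le`), and the gauges with a smaller
level, or with a non-strict inequality and a level below `1 / 2`, lie in between.
-/

namespace BesselBMO
open Filter Topology

/-! ### Admissible measures on the half-line -/

/-- A measure on `ℝ₊` which is absolutely continuous and gives every bounded open interval
`(a, b)` with `0 ≤ a < b` positive finite mass. -/
structure Admissible (κ : Measure ℝ) : Prop where
  ac : κ ≪ leb
  ne_zero : ∀ a b : ℝ, 0 ≤ a → a < b → κ (Ioo a b) ≠ 0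
  ne_top : ∀ a b : ℝ, 0 ≤ a → a < b → κ (Ioo a b) ≠ ∞

namespace Admissible

variable {κ : Measure ℝ}

theorem measure_Ioo_ne_top (h : Admissible κ) (a b : ℝ) : κ (Ioo a b) ≠ ∞ := by
  have h0 : κ (Iic 0) = 0 := h.ac (by
    rw [leb, Measure.restrict_apply measurableSet_Iic, Iic_inter_Ioi, Ioc_self, measure_empty])
  have hsub : Ioo a b ⊆ Iic 0 ∪ Ioo 0 (max b 1) := by
    intro x hx
    rcases le_or_gt x 0 with h | h
    · exact Or.inl h
    · exact Or.inr ⟨h, lt_max_of_lt_left hx.2⟩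
  refine ne_top_of_le_ne_top ?_ ((measure_mono hsub).trans (measure_union_le _ _))
  rw [h0, zero_add]
  exact h.ne_top 0 _ le_rfl (by positivity)

theorem nullSingleton (h : Admissible κ) : NullSingletonClass κ :=
  ⟨fun x => h.ac (by
    refine le_antisymm ((Measure.restrict_apply_le _ _).trans ?_) zero_le
    simp)⟩

theorem isLocallyFiniteMeasure (h : Admissible κ) : IsLocallyFiniteMeasure κ :=
  ⟨fun x => ⟨Ioo (x - 1) (x + 1), Ioo_mem_nhds (by linarith) (by linarith),
    (h.measure_Ioo_ne_top _ _).lt_top⟩⟩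

theorem measure_ne_top (h : Admissible κ) {a b : ℝ} {E : Set ℝ} (hE : E ⊆ Ioo a b) :
    κ E ≠ ∞ :=
  measure_ne_top_of_subset hE (h.measure_Ioo_ne_top a b)

theorem real_mono (h : Admissible κ) {a b : ℝ} {E F : Set ℝ} (hEF : E ⊆ F)
    (hF : F ⊆ Ioo a b) : κ.real E ≤ κ.real F :=
  measureReal_mono hEF (h.measure_ne_top hF)

theorem real_pos (h : Admissible κ) {a b : ℝ} (ha : 0 ≤ a) (hab : a < b) :
    0 < κ.real (Ioo a b) :=
  ENNReal.toReal_pos (h.ne_zero a b ha hab) (h.ne_top a b ha hab)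

end Admissible

/-! ### Covering by intervals of density one half -/

/-- Almost every point of a set `E` that fills at most half of `(a, b)` lies in an open subinterval
of which `E` fills exactly half: shrink to a density point, and use continuity. -/
theorem ae_exists_half_interval {κ : Measure ℝ} (hκ : Admissible κ) {a b : ℝ}
    {E : Set ℝ} (hE : MeasurableSet E) (hEB : E ⊆ Ioo a b)
    (hhalf : κ.real E ≤ 1 / 2 * κ.real (Ioo a b)) :
    ∀ᵐ x ∂κ.restrict E, ∃ J : ℝ × ℝ, a ≤ J.1 ∧ J.2 ≤ b ∧ x ∈ Ioo J.1 J.2 ∧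
      κ.real (E ∩ Ioo J.1 J.2) = 1 / 2 * κ.real (Ioo J.1 J.2) := by
  have := hκ.nullSingleton
  have := hκ.isLocallyFiniteMeasure
  set g : ℝ → ℝ := fun y => E.indicator (fun _ => (1 : ℝ)) y - 1 / 2 with hg
  have hgi : ∀ u v, IntervalIntegrable g κ u v := by
    intro u v
    have hc : ∀ c : ℝ, IntegrableOn (fun _ : ℝ => c) (uIoc u v) κ := fun c => by
      refine integrableOn_const ?_ (by simp)
      exact (measure_ne_top_of_subset (t := uIoc u v) (s := Ioo (min u v - 1) (max u v + 1))
        (fun y hy => ⟨by linarith [hy.1], by linarith [hy.2]⟩) (hκ.measure_Ioo_ne_top _ _))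
    rw [intervalIntegrable_iff]
    exact ((hc 1).indicator hE).sub (hc (1 / 2))
  set G : ℝ → ℝ := fun t => ∫ y in a..t, g y ∂κ with hG
  have hGc : Continuous G := intervalIntegral.continuous_primitive hgi a
  have hGd : ∀ u v, u ≤ v → G v - G u = κ.real (E ∩ Ioo u v) - 1 / 2 * κ.real (Ioo u v) := by
    intro u v huv
    simp only [hG]
    rw [intervalIntegral.integral_interval_sub_left (hgi _ _) (hgi _ _),
      intervalIntegral.integral_of_le huv, integral_Ioc_eq_integral_Ioo]
    have hf : IntegrableOn (fun _ : ℝ => (1 : ℝ)) (Ioo u v) κ :=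
      integrableOn_const (hκ.measure_Ioo_ne_top _ _)
    simp only [hg]
    rw [integral_sub (hf.indicator hE) (integrableOn_const (hκ.measure_Ioo_ne_top _ _)),
      integral_indicator hE, setIntegral_const, measureReal_restrict_apply hE, setIntegral_const]
    simp [mul_comm]
  filter_upwards [Besicovitch.ae_tendsto_measure_inter_div κ E, ae_restrict_mem hE] with x hx hxE
  have hxB := hEB hxE
  have h1 : ∀ᶠ r in 𝓝[>] (0 : ℝ),
      1 / 2 < κ (E ∩ Metric.closedBall x r) / κ (Metric.closedBall x r) :=
    hx.eventually (lt_mem_nhds (by simp))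
  have h2 : ∀ᶠ r in 𝓝[>] (0 : ℝ), r < min (x - a) (b - x) :=
    mem_nhdsWithin_of_mem_nhds (Iio_mem_nhds (by
      simp only [lt_min_iff, sub_pos]; exact ⟨hxB.1, hxB.2⟩))
  obtain ⟨r, ⟨hr1, hr2⟩, hr0⟩ := ((h1.and h2).and self_mem_nhdsWithin).exists
  have hr0 : 0 < r := hr0
  obtain ⟨hra, hrb⟩ := lt_min_iff.1 hr2
  have hae : (Ioo (x - r) (x + r) : Set ℝ) =ᵐ[κ] Metric.closedBall x r := by
    rw [Real.closedBall_eq_Icc]; exact Ioo_ae_eq_Icc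
  rw [← measure_congr hae, ← measure_congr ((ae_eq_refl E).inter hae)] at hr1
  have hsmall : 0 < G (x + r) - G (x - r) := by
    rw [hGd _ _ (by linarith)]
    have hlt : 1 / 2 * κ (Ioo (x - r) (x + r)) < κ (E ∩ Ioo (x - r) (x + r)) :=
      ENNReal.mul_lt_of_lt_div hr1
    have := (ENNReal.toReal_lt_toReal
      (ENNReal.mul_ne_top (by simp) (hκ.measure_Ioo_ne_top _ _))
      (hκ.measure_ne_top inter_subset_right)).2 hlt
    rw [ENNReal.toReal_mul] at this
    simp only [Measure.real] at *
    norm_num at this ⊢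
    linarith
  have hbig : G b - G a ≤ 0 := by
    rw [hGd _ _ (by linarith), inter_eq_left.2 hEB]
    linarith
  have hc : ContinuousOn (fun θ : ℝ => G ((1 - θ) * (x + r) + θ * b)
      - G ((1 - θ) * (x - r) + θ * a)) (Icc 0 1) :=
    ((hGc.comp (by fun_prop)).sub (hGc.comp (by fun_prop))).continuousOn
  obtain ⟨θ, hθ, hθ0⟩ := intermediate_value_Icc' zero_le_one hc
    (show (0 : ℝ) ∈ _ from ⟨by simpa using hbig, by simpa using hsmall.le⟩)
  have e1 : 0 ≤ θ * (x - r - a) := mul_nonneg hθ.1 (by linarith)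
  have e2 : 0 ≤ (1 - θ) * (x - r - a) := mul_nonneg (by linarith [hθ.2]) (by linarith)
  have e3 : 0 ≤ θ * (b - (x + r)) := mul_nonneg hθ.1 (by linarith)
  have e4 : 0 ≤ (1 - θ) * (b - (x + r)) := mul_nonneg (by linarith [hθ.2]) (by linarith)
  refine ⟨((1 - θ) * (x - r) + θ * a, (1 - θ) * (x + r) + θ * b), by dsimp only; linarith,
    by dsimp only; linarith, ⟨by dsimp only; linarith, by dsimp only; linarith⟩, ?_⟩
  have := hGd ((1 - θ) * (x - r) + θ * a) ((1 - θ) * (x + r) + θ * b) (by linarith)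
  dsimp only at hθ0 ⊢
  linarith

/-- A finite family of open intervals has a subfamily with the same union in which no point is
covered more than twice: among three intervals with a common point, one is superfluous. -/
theorem exists_subset_cover_card_le_two (T₀ : Finset (ℝ × ℝ)) :
    ∃ T ⊆ T₀, (⋃ J ∈ T, Ioo J.1 J.2) = ⋃ J ∈ T₀, Ioo J.1 J.2 ∧
      ∀ x : ℝ, (T.filter (fun J => x ∈ Ioo J.1 J.2)).card ≤ 2 := by
  classical
  induction T₀ using Finset.strongInduction with
  | H T₀ ih =>
    by_cases h : ∀ x : ℝ, (T₀.filter (fun J => x ∈ Ioo J.1 J.2)).card ≤ 2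
    · exact ⟨T₀, Finset.Subset.refl _, rfl, h⟩
    push Not at h
    obtain ⟨x, hx⟩ := h
    set F := T₀.filter (fun J => x ∈ Ioo J.1 J.2) with hF
    have hne : F.Nonempty := Finset.card_pos.1 (by omega)
    obtain ⟨P, hP, hPmin⟩ := F.exists_min_image (fun J => J.1) hne
    obtain ⟨Q, hQ, hQmax⟩ := F.exists_max_image (fun J => J.2) hne
    obtain ⟨J, hJ, hJPQ⟩ : ∃ J ∈ F, J ∉ ({P, Q} : Finset (ℝ × ℝ)) :=
      Finset.exists_mem_notMem_of_card_lt_card (lt_of_le_of_lt Finset.card_le_two hx)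
    simp only [Finset.mem_insert, Finset.mem_singleton, not_or] at hJPQ
    rw [hF, Finset.mem_filter] at hP hQ
    have hJT : J ∈ T₀ := (Finset.mem_filter.1 hJ).1
    obtain ⟨T, hT, hTU, hT2⟩ := ih (T₀.erase J) (Finset.erase_ssubset hJT)
    refine ⟨T, hT.trans (Finset.erase_subset _ _), hTU.trans ?_, hT2⟩
    refine Subset.antisymm (biUnion_subset_biUnion_left (Finset.erase_subset _ _)) ?_
    refine iUnion₂_subset fun I hI => ?_
    by_cases hIJ : I = J
    · subst hIJ
      intro y hy
      rcases le_or_gt y x with hyx | hyx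
      · exact mem_iUnion₂.2 ⟨P, Finset.mem_erase.2 ⟨Ne.symm hJPQ.1, hP.1⟩,
          (hPmin I hJ).trans_lt hy.1, hyx.trans_lt hP.2.2⟩
      · exact mem_iUnion₂.2 ⟨Q, Finset.mem_erase.2 ⟨Ne.symm hJPQ.2, hQ.1⟩,
          hQ.2.1.trans hyx, hy.2.trans_le (hQmax I hJ)⟩
    · exact subset_biUnion_of_mem (u := fun J : ℝ × ℝ => Ioo J.1 J.2)
        (Finset.mem_coe.2 (Finset.mem_erase.2 ⟨hIJ, hI⟩))

/-- Up to mass `ε`, a set `E` filling at most half of `(a, b)` is covered by finitely many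
subintervals of which it fills exactly half and which overlap at most twice. The mass of the
uncovered part may be measured by another measure `m`. -/
theorem exists_half_cover {κ m : Measure ℝ} (hκ : Admissible κ) (hm : Admissible m)
    (hmκ : m ≪ κ) {a b : ℝ} {E : Set ℝ} (hE : MeasurableSet E) (hEB : E ⊆ Ioo a b)
    (hhalf : κ.real E ≤ 1 / 2 * κ.real (Ioo a b)) {ε : ℝ} (hε : 0 < ε) :
    ∃ T : Finset (ℝ × ℝ),
      (∀ J ∈ T, a ≤ J.1 ∧ J.1 < J.2 ∧ J.2 ≤ b ∧
        κ.real (E ∩ Ioo J.1 J.2) = 1 / 2 * κ.real (Ioo J.1 J.2)) ∧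
      (∀ x : ℝ, (T.filter (fun J => x ∈ Ioo J.1 J.2)).card ≤ 2) ∧
      m.real (E \ ⋃ J ∈ T, Ioo J.1 J.2) ≤ ε := by
  classical
  set 𝒥 : Set (ℝ × ℝ) := {J | a ≤ J.1 ∧ J.1 < J.2 ∧ J.2 ≤ b ∧
    κ.real (E ∩ Ioo J.1 J.2) = 1 / 2 * κ.real (Ioo J.1 J.2)} with hJ
  set U : Set ℝ := ⋃ J : 𝒥, Ioo J.1.1 J.1.2 with hU
  have hUo : IsOpen U := isOpen_iUnion fun _ => isOpen_Ioo
  have hEU : m (E \ U) = 0 := by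
    apply hmκ
    have h := ae_exists_half_interval hκ hE hEB hhalf
    rw [ae_restrict_iff' hE] at h
    refine measure_mono_null ?_ h
    intro x hx hx'
    obtain ⟨J, h1, h2, h3, h4⟩ := hx' hx.1
    exact hx.2 (mem_iUnion.2 ⟨⟨J, h1, h3.1.trans h3.2, h2, h4⟩, h3⟩)
  have := hm.isLocallyFiniteMeasure
  obtain ⟨K, hKE, hK, hKε⟩ := (hE.inter hUo.measurableSet).exists_isCompact_sdiff_lt
    (μ := m) (hm.measure_ne_top (inter_subset_left.trans hEB))
    (ε := ENNReal.ofReal ε) (by simpa using hε)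
  obtain ⟨t, ht⟩ := hK.elim_finite_subcover (fun J : 𝒥 => Ioo J.1.1 J.1.2)
    (fun _ => isOpen_Ioo) (hKE.trans inter_subset_right)
  obtain ⟨T, hT, hTU, hT2⟩ := exists_subset_cover_card_le_two (t.image Subtype.val)
  refine ⟨T, fun J hJT => ?_, hT2, ?_⟩
  · obtain ⟨I, -, rfl⟩ := Finset.mem_image.1 (hT hJT)
    exact I.2
  · have hsub : E \ (⋃ J ∈ T, Ioo J.1 J.2) ⊆ (E \ U) ∪ ((E ∩ U) \ K) := by
      intro x hx
      by_cases hxU : x ∈ U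
      · refine Or.inr ⟨⟨hx.1, hxU⟩, fun hxK => hx.2 ?_⟩
        rw [hTU]
        obtain ⟨J, hJt, hxJ⟩ := mem_iUnion₂.1 (ht hxK)
        exact mem_iUnion₂.2 ⟨J.1, Finset.mem_image_of_mem _ hJt, hxJ⟩
      · exact Or.inl ⟨hx.1, hxU⟩
    refine ENNReal.toReal_le_of_le_ofReal hε.le ?_
    refine ((measure_mono hsub).trans (measure_union_le _ _)).trans ?_
    rw [hEU, zero_add]
    exact hKε.le

/-- If a set `P` fills at least the proportion `θ` of each interval of a family that overlaps at
most twice, then it fills at least the proportion `θ / 2` of the union. -/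
theorem mul_real_biUnion_le {m : Measure ℝ} (hm : Admissible m) {T : Finset (ℝ × ℝ)}
    (hT2 : ∀ x : ℝ, (T.filter (fun J => x ∈ Ioo J.1 J.2)).card ≤ 2)
    {P : Set ℝ} (hP : MeasurableSet P) {θ : ℝ} (hθ : 0 ≤ θ)
    (h : ∀ J ∈ T, θ * m.real (Ioo J.1 J.2) ≤ m.real (P ∩ Ioo J.1 J.2)) :
    θ * m.real (⋃ J ∈ T, Ioo J.1 J.2) ≤ 2 * m.real (P ∩ ⋃ J ∈ T, Ioo J.1 J.2) := by
  set V : Set ℝ := ⋃ J ∈ T, Ioo J.1 J.2 with hV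
  have hVm : MeasurableSet V := T.measurableSet_biUnion fun _ _ => measurableSet_Ioo
  have hVtop : m V ≠ ∞ := by
    refine ne_top_of_le_ne_top ?_ (measure_biUnion_finset_le T _)
    exact ENNReal.sum_ne_top.2 fun J _ => hm.measure_Ioo_ne_top _ _
  have hsum : ∑ J ∈ T, m (P ∩ Ioo J.1 J.2) ≤ 2 * m (P ∩ V) := by
    calc ∑ J ∈ T, m (P ∩ Ioo J.1 J.2)
        = ∑ J ∈ T, ∫⁻ x, (P ∩ Ioo J.1 J.2).indicator 1 x ∂m := by
          refine Finset.sum_congr rfl fun J _ => ?_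
          rw [lintegral_indicator_one (hP.inter measurableSet_Ioo)]
      _ = ∫⁻ x, ∑ J ∈ T, (P ∩ Ioo J.1 J.2).indicator 1 x ∂m := by
          rw [lintegral_finsetSum]
          exact fun J _ => measurable_one.indicator (hP.inter measurableSet_Ioo)
      _ ≤ ∫⁻ x, 2 * (P ∩ V).indicator 1 x ∂m := by
          refine lintegral_mono fun x => ?_
          by_cases hxP : x ∈ P ∩ V
          · have h1 : ∀ J ∈ T, (P ∩ Ioo J.1 J.2).indicator (1 : ℝ → ℝ≥0∞) x
                = if x ∈ Ioo J.1 J.2 then 1 else 0 := by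
              intro J _
              simp [indicator, hxP.1]
            rw [Finset.sum_congr rfl h1, Finset.sum_boole, indicator_of_mem hxP]
            simpa using (Nat.cast_le (α := ℝ≥0∞)).2 (hT2 x)
          · rw [Finset.sum_eq_zero]
            · exact zero_le
            · intro J hJ
              refine indicator_of_notMem (fun hx => hxP ⟨hx.1, ?_⟩) _
              exact mem_iUnion₂.2 ⟨J, hJ, hx.2⟩
      _ = 2 * m (P ∩ V) := by
          rw [lintegral_const_mul _ (measurable_one.indicator (hP.inter hVm)),
            lintegral_indicator_one (hP.inter hVm)]
  have hsum' : ∑ J ∈ T, m.real (P ∩ Ioo J.1 J.2) ≤ 2 * m.real (P ∩ V) := by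
    have := ENNReal.toReal_mono
      (ENNReal.mul_ne_top (by simp) (measure_ne_top_of_subset inter_subset_right hVtop)) hsum
    rwa [ENNReal.toReal_mul, ENNReal.toReal_sum
      (fun J _ => hm.measure_ne_top inter_subset_right)] at this
  calc θ * m.real V ≤ θ * ∑ J ∈ T, m.real (Ioo J.1 J.2) := by
        gcongr
        exact measureReal_biUnion_finset_le T _
    _ = ∑ J ∈ T, θ * m.real (Ioo J.1 J.2) := Finset.mul_sum _ _ _
    _ ≤ ∑ J ∈ T, m.real (P ∩ Ioo J.1 J.2) := Finset.sum_le_sum h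
    _ ≤ 2 * m.real (P ∩ V) := hsum'

/-! ### Exponential decay of the distribution function -/

/-- On each interval `(a, b)`, `f` is within `A` of a constant on more than half of the interval,
in the sense of the measure `κ`. -/
def MedianBounded (κ : Measure ℝ) (f : ℝ → ℝ) (A : ℝ) : Prop :=
  ∀ a b : ℝ, 0 ≤ a → a < b → ∃ c : ℝ,
    κ.real {x | x ∈ Ioo a b ∧ A < |f x - c|} < 1 / 2 * κ.real (Ioo a b)

theorem measurableSet_sep_lt {f : ℝ → ℝ} (hf : Measurable f) (a b l : ℝ) :
    MeasurableSet {x | x ∈ Ioo a b ∧ l < f x} :=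
  measurableSet_Ioo.inter (measurableSet_lt measurable_const hf)

theorem Admissible.real_sep_mono {κ : Measure ℝ} (hκ : Admissible κ) (a b : ℝ) {P Q : ℝ → Prop}
    (h : ∀ x, P x → Q x) :
    κ.real {x | x ∈ Ioo a b ∧ P x} ≤ κ.real {x | x ∈ Ioo a b ∧ Q x} :=
  hκ.real_mono (a := a) (b := b) (fun x hx => ⟨hx.1, h x hx.2⟩) (fun _ hx => hx.1)

theorem MedianBounded.neg {κ : Measure ℝ} {f : ℝ → ℝ} {A : ℝ} (h : MedianBounded κ f A) :
    MedianBounded κ (fun x => -f x) A := by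
  intro a b ha hab
  obtain ⟨c, hc⟩ := h a b ha hab
  refine ⟨-c, ?_⟩
  have : ∀ x, |-f x - -c| = |f x - c| := fun x => by rw [← abs_neg]; congr 1; ring
  simpa only [this] using hc

/-- The level set `{f > l}` is covered by intervals `J` of which it fills exactly half. The constant
attached to such a `J` must be within `A` of `l`, since `f` is close to it on more than half of `J`;
hence `{l - 2 A < f ≤ l + 2 A}` fills more than half of `J`, and so it is not small
compared with `{f > l}`. -/
theorem MedianBounded.real_lt_add_le {κ : Measure ℝ} (hκ : Admissible κ) {f : ℝ → ℝ}
    (hf : Measurable f) {A : ℝ} (hA : 0 ≤ A) (hmed : MedianBounded κ f A) {a b : ℝ} (ha : 0 ≤ a)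
    {l : ℝ}
    (hl : κ.real {x | x ∈ Ioo a b ∧ l < f x} ≤ 1 / 2 * κ.real (Ioo a b)) :
    κ.real {x | x ∈ Ioo a b ∧ l + 2 * A < f x} ≤
      4 / 5 * κ.real {x | x ∈ Ioo a b ∧ l - 2 * A < f x} := by
  set E := {x | x ∈ Ioo a b ∧ l < f x} with hE
  set Ep := {x | x ∈ Ioo a b ∧ l + 2 * A < f x} with hEp_def
  set Em := {x | x ∈ Ioo a b ∧ l - 2 * A < f x} with hEm_def
  have hEmeas : MeasurableSet E := measurableSet_sep_lt hf a b l
  have hEpmeas : MeasurableSet Ep := measurableSet_sep_lt hf a b _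
  have hEmmeas : MeasurableSet Em := measurableSet_sep_lt hf a b _
  have hEB : E ⊆ Ioo a b := fun x hx => hx.1
  have hEmB : Em ⊆ Ioo a b := fun x hx => hx.1
  have hpE : Ep ⊆ E := fun x hx => ⟨hx.1, by linarith [hx.2]⟩
  have hpm : Ep ⊆ Em := fun x hx => ⟨hx.1, by linarith [hx.2]⟩
  have hM : κ.real (Em \ Ep) = κ.real Em - κ.real Ep :=
    measureReal_sdiff hpm hEpmeas (hκ.measure_ne_top hEmB)
  have key : ∀ ε : ℝ, 0 < ε → κ.real E ≤ 4 * κ.real (Em \ Ep) + ε := by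
    intro ε hε
    obtain ⟨T, hT, hT2, hTε⟩ := exists_half_cover hκ hκ Measure.AbsolutelyContinuous.rfl
      hEmeas hEB hl hε
    set V : Set ℝ := ⋃ J ∈ T, Ioo J.1 J.2 with hV
    have hVm : MeasurableSet V := T.measurableSet_biUnion fun _ _ => measurableSet_Ioo
    have hVB : V ⊆ Ioo a b :=
      iUnion₂_subset fun J hJ => Ioo_subset_Ioo (hT J hJ).1 (hT J hJ).2.2.1
    have hJM : ∀ J ∈ T, 1 / 2 * κ.real (Ioo J.1 J.2)
        ≤ κ.real ((Em \ Ep) ∩ Ioo J.1 J.2) := by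
      intro J hJ
      obtain ⟨haJ, hJJ, hJb, hhalf⟩ := hT J hJ
      have hJB : Ioo J.1 J.2 ⊆ Ioo a b := Ioo_subset_Ioo haJ hJb
      obtain ⟨c, hc⟩ := hmed J.1 J.2 (ha.trans haJ) hJJ
      set N := {x | x ∈ Ioo J.1 J.2 ∧ A < |f x - c|} with hN
      have hNm : MeasurableSet N :=
        measurableSet_sep_lt (f := fun x => |f x - c|) (by fun_prop) _ _ _
      have hNB : N ⊆ Ioo J.1 J.2 := fun x hx => hx.1
      have hEc : κ.real (Ioo J.1 J.2 \ E) = 1 / 2 * κ.real (Ioo J.1 J.2) := by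
        have := measureReal_inter_add_sdiff (μ := κ) (s := Ioo J.1 J.2) hEmeas
          (hκ.measure_Ioo_ne_top _ _)
        rw [inter_comm] at this
        linarith
      -- The good part of `J` has more than half of the mass, so it meets `E` and its complement.
      obtain ⟨y, hyJ, hyN⟩ : ∃ y ∈ E ∩ Ioo J.1 J.2, y ∉ N := by
        by_contra! hcon
        have := hκ.real_mono hcon hNB
        linarith
      obtain ⟨z, hzJ, hzN⟩ : ∃ z ∈ Ioo J.1 J.2 \ E, z ∉ N := by
        by_contra! hcon
        have := hκ.real_mono hcon hNB
        linarith
      have hy1 : |f y - c| ≤ A := not_lt.1 fun h => hyN ⟨hyJ.2, h⟩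
      have hz1 : |f z - c| ≤ A := not_lt.1 fun h => hzN ⟨hzJ.1, h⟩
      have hy2 : l < f y := hyJ.1.2
      have hz2 : f z ≤ l := not_lt.1 fun h => hzJ.2 ⟨hJB hzJ.1, h⟩
      rw [abs_le] at hy1 hz1
      have hsub : Ioo J.1 J.2 \ N ⊆ (Em \ Ep) ∩ Ioo J.1 J.2 := by
        intro x hx
        have hx1 : |f x - c| ≤ A := not_lt.1 fun h => hx.2 ⟨hx.1, h⟩
        rw [abs_le] at hx1
        exact ⟨⟨⟨hJB hx.1, by linarith⟩, fun h => by linarith [h.2]⟩, hx.1⟩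
      have h1 := hκ.real_mono hsub inter_subset_right
      rw [measureReal_sdiff hNB hNm (hκ.measure_Ioo_ne_top _ _)] at h1
      linarith
    have hQ := mul_real_biUnion_le hκ hT2 (hEmmeas.diff hEpmeas) (by norm_num) hJM
    have h1 : κ.real ((Em \ Ep) ∩ V) ≤ κ.real (Em \ Ep) :=
      hκ.real_mono inter_subset_left (sdiff_subset.trans hEmB)
    have h2 : κ.real (E ∩ V) ≤ κ.real V := hκ.real_mono inter_subset_right hVB
    have h3 := measureReal_inter_add_sdiff (μ := κ) (s := E) hVm (hκ.measure_ne_top hEB)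
    linarith
  have h1 : κ.real E ≤ 4 * κ.real (Em \ Ep) := le_of_forall_pos_le_add key
  have h2 : κ.real Ep ≤ κ.real E := hκ.real_mono hpE hEB
  linarith

theorem MedianBounded.real_lt_le_pow {κ : Measure ℝ} (hκ : Admissible κ) {f : ℝ → ℝ}
    (hf : Measurable f) {A : ℝ} (hA : 0 ≤ A) (hmed : MedianBounded κ f A) {a b : ℝ} (ha : 0 ≤ a)
    {l : ℝ}
    (hl : κ.real {x | x ∈ Ioo a b ∧ l < f x} ≤ 1 / 2 * κ.real (Ioo a b)) (k : ℕ) :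
    κ.real {x | x ∈ Ioo a b ∧ l + 4 * k * A < f x} ≤
      (4 / 5) ^ k * (1 / 2 * κ.real (Ioo a b)) := by
  induction k with
  | zero => simpa using hl
  | succ k ih =>
    have hlev : κ.real {x | x ∈ Ioo a b ∧ l + 4 * k * A + 2 * A < f x} ≤
        1 / 2 * κ.real (Ioo a b) := by
      refine (hκ.real_sep_mono a b fun x hx => ?_).trans hl
      have : 0 ≤ 4 * k * A := by positivity
      linarith
    have h := hmed.real_lt_add_le hκ hf hA ha hlev
    have e1 : l + 4 * k * A + 2 * A + 2 * A = l + 4 * (k + 1 : ℕ) * A := by push_cast; ring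
    have e2 : l + 4 * k * A + 2 * A - 2 * A = l + 4 * k * A := by ring
    rw [e1, e2] at h
    calc _ ≤ _ := h
      _ ≤ 4 / 5 * ((4 / 5) ^ k * (1 / 2 * κ.real (Ioo a b))) := by gcongr
      _ = _ := by ring

/-- A John–Nirenberg inequality: if `f` is within `A' ≥ A` of `c` on at least half of `(a, b)`, then
the distribution function of `|f - c|` decays exponentially. No doubling condition is needed. -/
theorem MedianBounded.real_lt_abs_sub_le_pow {κ : Measure ℝ} (hκ : Admissible κ) {f : ℝ → ℝ}
    (hf : Measurable f) {A : ℝ} (hA : 0 ≤ A) (hmed : MedianBounded κ f A) {a b : ℝ} (ha : 0 ≤ a)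
    {c A' : ℝ} (hAA' : A ≤ A')
    (hc : κ.real {x | x ∈ Ioo a b ∧ A' < |f x - c|} ≤ 1 / 2 * κ.real (Ioo a b)) (k : ℕ) :
    κ.real {x | x ∈ Ioo a b ∧ (4 * k + 1) * A' < |f x - c|} ≤
      (4 / 5) ^ k * κ.real (Ioo a b) := by
  have h1 : κ.real {x | x ∈ Ioo a b ∧ c + A' < f x} ≤ 1 / 2 * κ.real (Ioo a b) :=
    (hκ.real_sep_mono a b fun x hx => lt_of_lt_of_le (by linarith) (le_abs_self (f x - c))).trans hc
  have h2 : κ.real {x | x ∈ Ioo a b ∧ -c + A' < -f x} ≤ 1 / 2 * κ.real (Ioo a b) :=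
    (hκ.real_sep_mono a b fun x hx => lt_of_lt_of_le (by linarith) (neg_le_abs (f x - c))).trans hc
  have h3 := hmed.real_lt_le_pow hκ hf hA ha h1 k
  have h4 := hmed.neg.real_lt_le_pow hκ (show Measurable fun x => -f x from hf.neg) hA ha h2 k
  have hk : 4 * k * A ≤ 4 * k * A' := by gcongr
  have hsub : {x | x ∈ Ioo a b ∧ (4 * k + 1) * A' < |f x - c|} ⊆
      {x | x ∈ Ioo a b ∧ c + A' + 4 * k * A < f x} ∪
      {x | x ∈ Ioo a b ∧ -c + A' + 4 * k * A < -f x} := by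
    rintro x ⟨hx, hx'⟩
    rcases lt_abs.1 hx' with h | h
    · exact Or.inl ⟨hx, by linarith⟩
    · exact Or.inr ⟨hx, by linarith⟩
  have h5 := hκ.real_mono hsub (union_subset (fun x hx => hx.1) (fun x hx => hx.1))
  have h6 := h5.trans (measureReal_union_le _ _)
  linarith

theorem summable_shift_pow_mul_geometric (N : ℕ) :
    Summable fun k : ℕ => (4 * (k : ℝ) + 5) ^ N * (4 / 5 : ℝ) ^ k := by
  have h := (summable_nat_add_iff 1).2
    (summable_pow_mul_geometric_of_norm_lt_one N (r := (4 / 5 : ℝ)) (by norm_num))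
  refine Summable.of_nonneg_of_le (fun k => by positivity) (fun k => ?_)
    (h.mul_left (5 ^ N * (5 / 4)))
  calc (4 * (k : ℝ) + 5) ^ N * (4 / 5 : ℝ) ^ k
      ≤ (5 * (k + 1)) ^ N * (4 / 5 : ℝ) ^ k := by
        gcongr
        linarith [(Nat.cast_nonneg k : (0 : ℝ) ≤ k)]
    _ = 5 ^ N * (5 / 4) * (((k + 1 : ℕ) : ℝ) ^ N * (4 / 5) ^ (k + 1)) := by
        rw [mul_pow, pow_succ]; push_cast; ring

/-- The exponential decay gives control of all the `L^p` means of `f - c`. -/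
theorem exists_lintegral_rpow_le {p : ℝ} (hp : 0 ≤ p) : ∃ C : ℝ≥0, ∀ κ : Measure ℝ, Admissible κ →
    ∀ f : ℝ → ℝ, Measurable f → ∀ A A' : ℝ, 0 ≤ A → A ≤ A' → 0 < A' → MedianBounded κ f A →
    ∀ a b c : ℝ, 0 ≤ a →
    κ.real {x | x ∈ Ioo a b ∧ A' < |f x - c|} ≤ 1 / 2 * κ.real (Ioo a b) →
    ∫⁻ x in Ioo a b, ‖f x - c‖ₑ ^ p ∂κ ≤ C * ENNReal.ofReal A' ^ p * κ (Ioo a b) := by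
  set N := ⌈p⌉₊
  set S : ℝ := ∑' k : ℕ, (4 * (k : ℝ) + 5) ^ N * (4 / 5 : ℝ) ^ k with hS
  have hS0 : 0 ≤ S := tsum_nonneg fun k => by positivity
  refine ⟨Real.toNNReal (1 + S), ?_⟩
  intro κ hκ f hf A A' hA hAA' hA' hmed a b c ha hc
  set L : ℕ → Set ℝ := fun k => {x | x ∈ Ioo a b ∧ (4 * k + 1) * A' < |f x - c|} with hL
  have hLm : ∀ k, MeasurableSet (L k) := fun k =>
    measurableSet_sep_lt (f := fun x => |f x - c|) (by fun_prop) _ _ _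
  have hdecay : ∀ k, κ (L k) ≤ ENNReal.ofReal ((4 / 5) ^ k) * κ (Ioo a b) := by
    intro k
    have h := hmed.real_lt_abs_sub_le_pow hκ hf hA ha hAA' hc k
    have h' := ENNReal.ofReal_le_ofReal h
    rwa [ENNReal.ofReal_mul (by positivity), ofReal_measureReal (hκ.measure_Ioo_ne_top _ _),
      ofReal_measureReal (hκ.measure_ne_top (fun x hx => hx.1))] at h'
  have hpt : ∀ x ∈ Ioo a b, ‖f x - c‖ₑ ^ p ≤ ENNReal.ofReal A' ^ p *
      (1 + ∑' k : ℕ, (L k).indicator (fun _ => ENNReal.ofReal ((4 * (k : ℝ) + 5) ^ N)) x) := by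
    intro x hx
    rw [Real.enorm_eq_ofReal_abs]
    rcases le_or_gt |f x - c| A' with h | h
    · calc ENNReal.ofReal |f x - c| ^ p ≤ ENNReal.ofReal A' ^ p := by gcongr
        _ ≤ _ := le_mul_of_one_le_right' le_self_add
    · set y := (|f x - c| / A' - 1) / 4 with hy
      have hy0 : 0 < y := by
        have : 1 < |f x - c| / A' := by rwa [one_lt_div hA']
        simp only [hy]; linarith
      -- `(4 k + 1) A'` is the last level strictly below `|f x - c|`.
      obtain ⟨k, hk1, hk2⟩ : ∃ k : ℕ, (k : ℝ) < y ∧ y ≤ k + 1 := by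
        refine ⟨⌈y⌉₊ - 1, ?_, ?_⟩
        · have h1 : 0 < ⌈y⌉₊ := Nat.ceil_pos.2 hy0
          have h2 := Nat.ceil_lt_add_one hy0.le
          rw [Nat.cast_sub (by omega)]; push_cast; linarith
        · have h1 : 0 < ⌈y⌉₊ := Nat.ceil_pos.2 hy0
          rw [Nat.cast_sub (by omega)]; push_cast; linarith [Nat.le_ceil y]
      have hyA : |f x - c| = (4 * y + 1) * A' := by
        simp only [hy]; field_simp; ring
      have hxk : x ∈ L k := by
        refine ⟨hx, ?_⟩
        rw [hyA]
        gcongr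
      have hle : ENNReal.ofReal |f x - c| ≤ ENNReal.ofReal A' * ENNReal.ofReal (4 * k + 5) := by
        rw [← ENNReal.ofReal_mul hA'.le]
        apply ENNReal.ofReal_le_ofReal
        rw [hyA, mul_comm]
        exact mul_le_mul_of_nonneg_left (by linarith) hA'.le
      calc ENNReal.ofReal |f x - c| ^ p
          ≤ (ENNReal.ofReal A' * ENNReal.ofReal (4 * k + 5)) ^ p := by gcongr
        _ = ENNReal.ofReal A' ^ p * ENNReal.ofReal (4 * k + 5) ^ p :=
            ENNReal.mul_rpow_of_nonneg _ _ hp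
        _ ≤ ENNReal.ofReal A' ^ p * ENNReal.ofReal ((4 * (k : ℝ) + 5) ^ N) := by
            gcongr
            rw [ENNReal.ofReal_rpow_of_nonneg (by positivity) hp]
            apply ENNReal.ofReal_le_ofReal
            rw [← Real.rpow_natCast]
            apply Real.rpow_le_rpow_of_exponent_le
            · linarith [(Nat.cast_nonneg k : (0 : ℝ) ≤ k)]
            · exact Nat.le_ceil p
        _ ≤ _ := by
            gcongr
            refine le_trans ?_ le_add_self
            refine le_trans ?_ (ENNReal.le_tsum k)
            rw [indicator_of_mem hxk]
  calc ∫⁻ x in Ioo a b, ‖f x - c‖ₑ ^ p ∂κ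
      ≤ ∫⁻ x in Ioo a b, ENNReal.ofReal A' ^ p * (1 + ∑' k : ℕ, (L k).indicator
          (fun _ => ENNReal.ofReal ((4 * (k : ℝ) + 5) ^ N)) x) ∂κ :=
        setLIntegral_mono' measurableSet_Ioo hpt
    _ = ENNReal.ofReal A' ^ p * (κ (Ioo a b) + ∑' k : ℕ,
          ENNReal.ofReal ((4 * (k : ℝ) + 5) ^ N) * κ (L k)) := by
        have hm : ∀ k, Measurable ((L k).indicator
            (fun _ : ℝ => ENNReal.ofReal ((4 * (k : ℝ) + 5) ^ N))) :=
          fun k => measurable_const.indicator (hLm k)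
        rw [lintegral_const_mul' _ _ (ENNReal.rpow_ne_top_of_nonneg hp ENNReal.ofReal_ne_top),
          lintegral_add_left measurable_const, setLIntegral_one,
          lintegral_tsum fun k => (hm k).aemeasurable]
        congr 3
        ext k
        rw [lintegral_indicator_const (hLm k), Measure.restrict_apply (hLm k),
          inter_eq_left.2 fun x hx => hx.1]
    _ ≤ ENNReal.ofReal A' ^ p * (κ (Ioo a b) + ∑' k : ℕ,
          ENNReal.ofReal ((4 * (k : ℝ) + 5) ^ N * (4 / 5) ^ k) * κ (Ioo a b)) := by
        gcongr _ * (_ + ?_)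
        refine ENNReal.tsum_le_tsum fun k => ?_
        rw [ENNReal.ofReal_mul (by positivity), mul_assoc]
        gcongr
        exact hdecay k
    _ = _ := by
        rw [ENNReal.tsum_mul_right, ← ENNReal.ofReal_tsum_of_nonneg (fun k => by positivity)
          (summable_shift_pow_mul_geometric N), ← hS,
          show ((Real.toNNReal (1 + S) : ℝ≥0) : ℝ≥0∞) = ENNReal.ofReal (1 + S) from rfl,
          ENNReal.ofReal_add zero_le_one hS0, ENNReal.ofReal_one]
        ring

/-! ### Comparison of measures -/

/-- Measurable subsets of an interval carrying at least half of its `m`-mass carry at least a fixed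
proportion of its `κ`-mass. This is a form of the `A_∞` condition. -/
def HalfComparable (κ m : Measure ℝ) : Prop :=
  ∃ δ : ℝ, 0 < δ ∧ ∀ a b : ℝ, 0 ≤ a → a < b → ∀ E : Set ℝ, MeasurableSet E → E ⊆ Ioo a b →
    1 / 2 * m.real (Ioo a b) ≤ m.real E → δ * κ.real (Ioo a b) ≤ κ.real E

/-- The comparison is symmetric. A set `E` of small `m`-mass is covered by intervals of which it
fills half with respect to `m`; it misses a fixed proportion of their `κ`-mass, while their union
has `m`-mass at most `4 m(E)`. Iterating gives small `κ`-mass. -/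
theorem HalfComparable.symm {κ m : Measure ℝ} (hκ : Admissible κ) (hm : Admissible m)
    (hκm : κ ≪ m) (h : HalfComparable κ m) : HalfComparable m κ := by
  obtain ⟨δ, hδ, h⟩ := h
  have hδ1 : δ ≤ 1 := by
    have h1 := h 0 1 le_rfl one_pos (Ioo 0 1) measurableSet_Ioo Subset.rfl
      (by linarith [hm.real_pos le_rfl one_pos])
    have h2 := hκ.real_pos le_rfl one_pos
    nlinarith
  have step : ∀ a b : ℝ, 0 ≤ a → a < b → ∀ E : Set ℝ, MeasurableSet E → E ⊆ Ioo a b →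
      m.real E ≤ 1 / 2 * m.real (Ioo a b) → ∀ ε : ℝ, 0 < ε → ∃ V : Set ℝ, MeasurableSet V ∧
      V ⊆ Ioo a b ∧ m.real V ≤ 4 * m.real E ∧ κ.real E ≤ (1 - δ / 2) * κ.real V + ε := by
    intro a b ha hab E hE hEB hhalf ε hε
    obtain ⟨T, hT, hT2, hTε⟩ := exists_half_cover hm hκ hκm hE hEB hhalf hε
    set V : Set ℝ := ⋃ J ∈ T, Ioo J.1 J.2 with hV
    have hVm : MeasurableSet V := T.measurableSet_biUnion fun _ _ => measurableSet_Ioo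
    have hVB : V ⊆ Ioo a b :=
      iUnion₂_subset fun J hJ => Ioo_subset_Ioo (hT J hJ).1 (hT J hJ).2.2.1
    refine ⟨V, hVm, hVB, ?_, ?_⟩
    · have hQ := mul_real_biUnion_le hm hT2 hE (θ := 1 / 2) (by norm_num)
        fun J hJ => (hT J hJ).2.2.2.ge
      have h1 : m.real (E ∩ V) ≤ m.real E := hm.real_mono inter_subset_left hEB
      linarith
    · have hQ := mul_real_biUnion_le hκ hT2 hE.compl hδ.le fun J hJ => by
        obtain ⟨haJ, hJJ, hJb, hhalf⟩ := hT J hJ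
        refine h J.1 J.2 (ha.trans haJ) hJJ _ (hE.compl.inter measurableSet_Ioo)
          inter_subset_right ?_
        have h1 := measureReal_inter_add_sdiff (μ := m) (s := Ioo J.1 J.2) hE
          (hm.measure_Ioo_ne_top _ _)
        rw [inter_comm, sdiff_eq, inter_comm (Ioo J.1 J.2)] at h1
        linarith
      have h1 := measureReal_inter_add_sdiff (μ := κ) (s := E) hVm (hκ.measure_ne_top hEB)
      have h2 := measureReal_inter_add_sdiff (μ := κ) (s := V) hE (hκ.measure_ne_top hVB)
      rw [inter_comm, sdiff_eq, inter_comm V] at h2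
      linarith
  have iter : ∀ k : ℕ, ∀ a b : ℝ, 0 ≤ a → a < b → ∀ E : Set ℝ, MeasurableSet E → E ⊆ Ioo a b →
      m.real E ≤ (1 / 4) ^ k * (1 / 2 * m.real (Ioo a b)) →
      κ.real E ≤ (1 - δ / 2) ^ k * κ.real (Ioo a b) := by
    intro k
    induction k with
    | zero =>
      intro a b _ _ E _ hEB _
      simpa using hκ.real_mono hEB Subset.rfl
    | succ k ih =>
      intro a b ha hab E hE hEB hEk
      have hB := hm.real_pos ha hab
      refine le_of_forall_pos_le_add fun ε hε => ?_
      obtain ⟨V, hVm, hVB, hV1, hV2⟩ := step a b ha hab E hE hEB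
        (hEk.trans (mul_le_of_le_one_left (by positivity)
          (pow_le_one₀ (by norm_num) (by norm_num)))) ε hε
      have hV3 := ih a b ha hab V hVm hVB (by
        rw [pow_succ] at hEk
        linarith)
      have hV4 := mul_le_mul_of_nonneg_left hV3 (show 0 ≤ 1 - δ / 2 by linarith)
      rw [pow_succ']
      linarith
  obtain ⟨k, hk⟩ := exists_pow_lt_of_lt_one (show (0 : ℝ) < 1 / 2 by norm_num)
    (show 1 - δ / 2 < 1 by linarith)
  refine ⟨(1 / 4) ^ k * (1 / 2), by positivity, fun a b ha hab E hE hEB hEκ => ?_⟩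
  by_contra! hlt
  have h1 := iter k a b ha hab E hE hEB (by linarith)
  have h2 := mul_lt_mul_of_pos_right hk (hκ.real_pos ha hab)
  linarith

/-- Under the comparison, a constant that fits `f` in the sense of `κ` also fits `f` in the sense
of `m`, with a larger bound. -/
theorem HalfComparable.exists_transfer {κ m : Measure ℝ} (hκ : Admissible κ)
    (h : HalfComparable κ m) : ∃ K : ℝ, 1 ≤ K ∧ ∀ f : ℝ → ℝ, Measurable f → ∀ A : ℝ, 0 ≤ A →
    MedianBounded κ f A → ∀ a b : ℝ, 0 ≤ a → a < b → ∃ c : ℝ,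
      κ.real {x | x ∈ Ioo a b ∧ A < |f x - c|} < 1 / 2 * κ.real (Ioo a b) ∧
      m.real {x | x ∈ Ioo a b ∧ K * A < |f x - c|} < 1 / 2 * m.real (Ioo a b) := by
  obtain ⟨δ, hδ, h⟩ := h
  obtain ⟨k, hk⟩ := exists_pow_lt_of_lt_one hδ (show (4 / 5 : ℝ) < 1 by norm_num)
  refine ⟨4 * k + 1, by linarith [(Nat.cast_nonneg k : (0 : ℝ) ≤ k)], ?_⟩
  intro f hf A hA hmed a b ha hab
  obtain ⟨c, hc⟩ := hmed a b ha hab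
  refine ⟨c, hc, ?_⟩
  have hdec := hmed.real_lt_abs_sub_le_pow hκ hf hA ha le_rfl hc.le k
  by_contra! hcon
  have h1 := h a b ha hab _ (measurableSet_sep_lt (f := fun x => |f x - c|) (by fun_prop) _ _ _)
    (fun x hx => hx.1) hcon
  have h2 := mul_lt_mul_of_pos_right hk (hκ.real_pos ha hab)
  linarith

theorem HalfComparable.exists_medianBounded {κ m : Measure ℝ} (hκ : Admissible κ)
    (h : HalfComparable κ m) : ∃ K : ℝ, 1 ≤ K ∧ ∀ f : ℝ → ℝ, Measurable f → ∀ A : ℝ, 0 ≤ A →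
    MedianBounded κ f A → MedianBounded m f (K * A) := by
  obtain ⟨K, hK, h⟩ := h.exists_transfer hκ
  exact ⟨K, hK, fun f hf A hA hmed a b ha hab =>
    let ⟨c, hc⟩ := h f hf A hA hmed a b ha hab; ⟨c, hc.2⟩⟩

/-! ### The weights -/

theorem leb_Ioo {a b : ℝ} (ha : 0 ≤ a) : leb (Ioo a b) = ENNReal.ofReal (b - a) := by
  rw [leb, Measure.restrict_apply measurableSet_Ioo,
    inter_eq_left.2 fun x (hx : x ∈ Ioo a b) => mem_Ioi.2 (ha.trans_lt hx.1), Real.volume_Ioo]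

theorem admissible_leb : Admissible leb where
  ac := Measure.AbsolutelyContinuous.rfl
  ne_zero a b ha hab := by simpa [leb_Ioo ha] using hab
  ne_top a b ha hab := by simp [leb_Ioo ha]

theorem wdx_absolutelyContinuous (w : ℝ → ℝ) : wdx w ≪ leb :=
  withDensity_absolutelyContinuous _ _

theorem wdx_apply (w : ℝ → ℝ) {E : Set ℝ} (hE : MeasurableSet E) :
    wdx w E = ∫⁻ x in E, ENNReal.ofReal (w x) ∂leb :=
  withDensity_apply _ hE

theorem wdx_one : wdx (fun _ => 1) = leb := by
  simp [wdx]

theorem nu_sub_half (lam : ℝ) : nu (lam - 1 / 2) = besselMu lam := by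
  have : 2 * (lam - 1 / 2) + 1 = 2 * lam := by ring
  rw [nu, besselMu, this]

theorem ae_leb_pos : ∀ᵐ x ∂leb, 0 < x := ae_restrict_mem measurableSet_Ioi

theorem leb_absolutelyContinuous_besselMu (lam : ℝ) : leb ≪ besselMu lam := by
  refine withDensity_absolutelyContinuous' ?_ ?_
  · exact (Measurable.pow_const measurable_id _).ennreal_ofReal.aemeasurable
  · filter_upwards [ae_leb_pos] with x hx
    simpa using Real.rpow_pos_of_pos hx _

theorem besselMu_le {lam : ℝ} (hlam : 0 < lam) {a b : ℝ} (ha : 0 ≤ a) :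
    besselMu lam (Ioo a b) ≤ ENNReal.ofReal (b ^ (2 * lam)) * leb (Ioo a b) := by
  rw [besselMu, wdx_apply _ measurableSet_Ioo, ← setLIntegral_const]
  refine setLIntegral_mono' measurableSet_Ioo fun x hx => ?_
  have hx0 : 0 < x := ha.trans_lt hx.1
  gcongr
  exact hx.2.le

theorem le_besselMu {lam : ℝ} (hlam : 0 < lam) {c : ℝ} (hc : 0 ≤ c) {E : Set ℝ}
    (hE : MeasurableSet E) (h : ∀ x ∈ E, c ≤ x) :
    ENNReal.ofReal (c ^ (2 * lam)) * leb E ≤ besselMu lam E := by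
  rw [besselMu, wdx_apply _ hE, ← setLIntegral_const]
  refine setLIntegral_mono' hE fun x hx => ?_
  gcongr
  exact h x hx

theorem admissible_besselMu {lam : ℝ} (hlam : 0 < lam) : Admissible (besselMu lam) where
  ac := wdx_absolutelyContinuous _
  ne_zero a b ha hab h := admissible_leb.ne_zero a b ha hab
    (leb_absolutelyContinuous_besselMu lam h)
  ne_top a b ha hab := ne_top_of_le_ne_top
    (ENNReal.mul_ne_top ENNReal.ofReal_ne_top (admissible_leb.ne_top a b ha hab))
    (besselMu_le hlam ha)

/-- At least a quarter of the length of a set filling half of `(a, b)` lies to the right of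
`b / 4`, where the density `x ^ (2 lam)` is comparable to its maximum. -/
theorem halfComparable_besselMu_leb {lam : ℝ} (hlam : 0 < lam) :
    HalfComparable (besselMu lam) leb := by
  have hμ := admissible_besselMu hlam
  refine ⟨(1 / 4) ^ (2 * lam) * (1 / 4), by positivity, fun a b ha hab E hE hEB hhalf => ?_⟩
  have hb : 0 < b := ha.trans_lt hab
  set d := a + (b - a) / 4 with hd
  have hd0 : 0 ≤ d := by linarith
  have hlebB : leb.real (Ioo a b) = b - a := by
    rw [Measure.real, leb_Ioo ha, ENNReal.toReal_ofReal (by linarith)]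
  have hsplit : E ⊆ (Ioc a d) ∪ (E ∩ Ioi d) := fun x hx => by
    rcases le_or_gt x d with h | h
    · exact Or.inl ⟨(hEB hx).1, h⟩
    · exact Or.inr ⟨hx, h⟩
  have hF : (b - a) / 4 ≤ leb.real (E ∩ Ioi d) := by
    have h1 : leb.real (Ioc a d) = (b - a) / 4 := by
      rw [Measure.real, leb, Measure.restrict_apply measurableSet_Ioc,
        inter_eq_left.2 fun x (hx : x ∈ Ioc a d) => mem_Ioi.2 (ha.trans_lt hx.1), Real.volume_Ioc,
        ENNReal.toReal_ofReal (by linarith)]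
      linarith
    have h2 : leb.real E ≤ leb.real (Ioc a d) + leb.real (E ∩ Ioi d) :=
      (admissible_leb.real_mono hsplit (b := b) (a := a)
        (union_subset (fun x hx => ⟨hx.1, by linarith [hx.2]⟩)
          (inter_subset_left.trans hEB))).trans (measureReal_union_le _ _)
    rw [hlebB] at hhalf
    linarith
  have h3 := le_besselMu hlam (c := b / 4) (by positivity) (hE.inter measurableSet_Ioi)
    fun x (hx : x ∈ E ∩ Ioi d) => by linarith [show d < x from hx.2]
  have h3' := ENNReal.toReal_mono (hμ.measure_ne_top (inter_subset_left.trans hEB)) h3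
  have h4 := ENNReal.toReal_mono (ENNReal.mul_ne_top ENNReal.ofReal_ne_top
    (admissible_leb.ne_top a b ha hab)) (besselMu_le hlam ha)
  rw [ENNReal.toReal_mul, ENNReal.toReal_ofReal (by positivity)] at h3' h4
  simp only [← Measure.real_def] at h3' h4
  have h5 : (besselMu lam).real (E ∩ Ioi d) ≤ (besselMu lam).real E :=
    hμ.real_mono inter_subset_left hEB
  have h6 : (b / 4) ^ (2 * lam) = (1 / 4) ^ (2 * lam) * b ^ (2 * lam) := by
    rw [← Real.mul_rpow (by norm_num) hb.le]; congr 1; ring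
  rw [hlebB] at h4
  calc (1 / 4) ^ (2 * lam) * (1 / 4) * (besselMu lam).real (Ioo a b)
      ≤ (1 / 4) ^ (2 * lam) * (1 / 4) * (b ^ (2 * lam) * (b - a)) := by gcongr
    _ = (b / 4) ^ (2 * lam) * ((b - a) / 4) := by rw [h6]; ring
    _ ≤ (b / 4) ^ (2 * lam) * leb.real (E ∩ Ioi d) := by gcongr
    _ ≤ (besselMu lam).real E := h3'.trans h5

/-- A weight, not almost everywhere zero, which is integrable on bounded intervals, and which is
almost everywhere positive on each interval of nonzero mass, defines an admissible measure: an
interval of mass zero would force all larger intervals, and so the half-line, to have mass zero. -/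
theorem admissible_wdx {w : ℝ → ℝ} (hw : NonnegMeasurable w)
    (hw0 : ¬ (∀ᵐ x ∂leb, w x = 0))
    (hfin : ∀ a b : ℝ, 0 ≤ a → a < b → wdx w (Ioo a b) ≠ ∞)
    (hpos : ∀ a b : ℝ, 0 ≤ a → a < b → wdx w (Ioo a b) ≠ 0 →
      ∀ᵐ x ∂(leb.restrict (Ioo a b)), 0 < w x) : Admissible (wdx w) where
  ac := wdx_absolutelyContinuous w
  ne_top := hfin
  ne_zero a b ha hab h := by
    have hb : 0 < b := ha.trans_lt hab
    have hz : ∀ n : ℕ, wdx w (Ioo 0 (b + n)) = 0 := by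
      intro n
      by_contra hne
      have h1 := hpos 0 (b + n) le_rfl (by positivity) hne
      have h2 : ∀ᵐ x ∂(leb.restrict (Ioo a b)), 0 < w x :=
        ae_restrict_of_ae_restrict_of_subset
          (Ioo_subset_Ioo ha (by linarith [(Nat.cast_nonneg n : (0 : ℝ) ≤ n)])) h1
      rw [wdx_apply _ measurableSet_Ioo,
        lintegral_eq_zero_iff' hw.1.ennreal_ofReal.restrict] at h
      have h3 : ∀ᵐ x ∂(leb.restrict (Ioo a b)), False := by
        filter_upwards [h, h2] with x hx hx'
        simp at hx
        linarith
      rw [ae_iff] at h3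
      simp at h3
      exact admissible_leb.ne_zero a b ha hab h3
    have hz' : wdx w (⋃ n : ℕ, Ioo 0 (b + n)) = 0 := measure_iUnion_null hz
    have hU : (⋃ n : ℕ, Ioo 0 (b + n)) = Ioi 0 := by
      ext x
      simp only [mem_iUnion, mem_Ioo, mem_Ioi]
      refine ⟨fun ⟨n, hn⟩ => hn.1, fun hx => ?_⟩
      obtain ⟨n, hn⟩ := exists_nat_gt (x - b)
      exact ⟨n, hx, by linarith⟩
    rw [hU, wdx_apply _ measurableSet_Ioi,
      lintegral_eq_zero_iff' hw.1.ennreal_ofReal.restrict] at hz'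
    apply hw0
    have hr : leb.restrict (Ioi 0) = leb := by
      rw [leb, Measure.restrict_restrict measurableSet_Ioi, inter_self]
    rw [hr] at hz'
    filter_upwards [hz', ae_leb_pos] with x hx hx0
    simp at hx
    exact le_antisymm hx (hw.2 x hx0)

theorem ae_Ioo_pos {a b : ℝ} : ∀ᵐ x ∂(leb.restrict (Ioo a b)), 0 < x :=
  ae_restrict_of_ae ae_leb_pos

/-- Integrating the `A_1` inequality over `E ⊆ (a, b)` against the Bessel measure gives
`w(B) / μ(B) * μ(E) ≤ C w(E)`. -/
theorem MemTildeAOne.admissible_and_halfComparable {lam : ℝ} (hlam : 0 < lam) {w : ℝ → ℝ}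
    (hw : MemTildeAOne (lam - 1 / 2) w) (hw0 : ¬ (∀ᵐ x ∂leb, w x = 0)) :
    Admissible (wdx w) ∧ HalfComparable (wdx w) (besselMu lam) := by
  obtain ⟨hwm, C, hC⟩ := hw
  have hμ := admissible_besselMu hlam
  have he : 2 * (lam - 1 / 2) + 1 = 2 * lam := by ring
  simp only [nu_sub_half, he] at hC
  have hadm : Admissible (wdx w) := by
    refine admissible_wdx hwm hw0 (fun a b ha hab htop => ?_) (fun a b ha hab hne => ?_)
    · have : NeBot (ae (leb.restrict (Ioo a b))) := by
        rw [ae_neBot, Ne, Measure.restrict_eq_zero]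
        exact admissible_leb.ne_zero a b ha hab
      obtain ⟨x, hx⟩ := (hC a b ha hab).exists
      rw [htop, ENNReal.top_div_of_ne_top (hμ.ne_top a b ha hab), top_le_iff] at hx
      exact ENNReal.mul_ne_top ENNReal.coe_ne_top ENNReal.ofReal_ne_top hx
    · filter_upwards [hC a b ha hab, ae_Ioo_pos] with x hx hx0
      by_contra! hwx
      have : w x / x ^ (2 * lam) ≤ 0 := div_nonpos_of_nonpos_of_nonneg hwx (by positivity)
      rw [ENNReal.ofReal_of_nonpos this, mul_zero, nonpos_iff_eq_zero,
        ENNReal.div_eq_zero_iff] at hx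
      exact hx.elim hne (hμ.ne_top a b ha hab)
  refine ⟨hadm, 1 / (2 * (C + 1)), by positivity, fun a b ha hab E hE hEB hhalf => ?_⟩
  have h1 : wdx w (Ioo a b) / besselMu lam (Ioo a b) * besselMu lam E ≤ C * wdx w E := by
    rw [besselMu, wdx_apply _ hE, wdx_apply w hE, ← besselMu,
      ← lintegral_const_mul' _ _ (ENNReal.div_ne_top (hadm.ne_top a b ha hab)
        (hμ.ne_zero a b ha hab)), ← lintegral_const_mul' _ _ ENNReal.coe_ne_top]
    refine lintegral_mono_ae ?_
    filter_upwards [ae_restrict_of_ae_restrict_of_subset hEB (hC a b ha hab),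
      ae_restrict_of_ae ae_leb_pos] with x hx hx0
    calc _ ≤ C * ENNReal.ofReal (w x / x ^ (2 * lam)) * ENNReal.ofReal (x ^ (2 * lam)) := by gcongr
      _ = _ := by
        rw [mul_assoc, ← ENNReal.ofReal_mul' (by positivity), div_mul_cancel₀ _ (by positivity)]
  have h2 := ENNReal.toReal_mono
    (ENNReal.mul_ne_top ENNReal.coe_ne_top (hadm.measure_ne_top hEB)) h1
  rw [ENNReal.toReal_mul, ENNReal.toReal_mul, ENNReal.toReal_div] at h2
  simp only [← Measure.real_def, ENNReal.coe_toReal] at h2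
  have hM := hμ.real_pos ha hab
  have h3 : (wdx w).real (Ioo a b) / 2 ≤ C * (wdx w).real E :=
    calc (wdx w).real (Ioo a b) / 2 = (wdx w).real (Ioo a b) / (besselMu lam).real (Ioo a b) *
          (1 / 2 * (besselMu lam).real (Ioo a b)) := by field_simp
      _ ≤ _ := by gcongr
      _ ≤ _ := h2
  have h4 : 0 ≤ (wdx w).real E := measureReal_nonneg
  rw [div_mul_eq_mul_div, one_mul, div_le_iff₀ (by positivity)]
  linarith

/-- With `σ(B)` the integral of the dual weight, Hölder's inequality gives
`μ(E) ^ p ≤ w(E) σ(B) ^ (p - 1)` for `E ⊆ B`, while the `A_p` condition says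
`w(B) σ(B) ^ (p - 1) ≤ C μ(B) ^ p`. That `w` is integrable and positive on intervals comes from the
conventions in `[0, ∞]`: otherwise one of the two factors would be infinite and the other not
zero. -/
theorem MemTildeA.admissible_and_halfComparable {lam : ℝ} (hlam : 0 < lam) {p : ℝ} (hp : 1 < p)
    {w : ℝ → ℝ} (hw : MemTildeA (lam - 1 / 2) p w) (hw0 : ¬ (∀ᵐ x ∂leb, w x = 0)) :
    Admissible (wdx w) ∧ HalfComparable (wdx w) (besselMu lam) := by
  obtain ⟨hwm, C, hC⟩ := hw
  have hμ := admissible_besselMu hlam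
  have he : 2 * (lam - 1 / 2) + 1 = 2 * lam := by ring
  have hp0 : 0 < p := by linarith
  have hp1 : 0 < p - 1 := by linarith
  have hq : 0 < 1 / (p - 1) := by positivity
  simp only [nu_sub_half, he] at hC
  set φ : ℝ → ℝ≥0∞ := fun t => ENNReal.ofReal (t ^ (2 * lam * (p / (p - 1)))) *
    ENNReal.ofReal (w t) ^ (-(1 / (p - 1))) with hφ
  have hφm : AEMeasurable φ leb :=
    ((Measurable.pow_const measurable_id _).ennreal_ofReal.aemeasurable).mul
      (hwm.1.ennreal_ofReal.pow_const _)
  set σ : ℝ → ℝ → ℝ≥0∞ := fun a b => ∫⁻ t in Ioo a b, φ t ∂leb with hσ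
  replace hC : ∀ a b : ℝ, 0 ≤ a → a < b → (besselMu lam (Ioo a b))⁻¹ * wdx w (Ioo a b) *
      ((besselMu lam (Ioo a b))⁻¹ * σ a b) ^ (p - 1) < C := by
    intro a b ha hab
    rw [wdx_apply _ measurableSet_Ioo]
    exact hC a b ha hab
  have hσ0 : ∀ a b : ℝ, 0 ≤ a → a < b → σ a b ≠ 0 := by
    intro a b ha hab h
    rw [hσ] at h
    dsimp only at h
    rw [lintegral_eq_zero_iff' hφm.restrict] at h
    have h3 : ∀ᵐ x ∂(leb.restrict (Ioo a b)), False := by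
      -- `w x` is finite, so its negative power does not vanish.
      filter_upwards [h, ae_Ioo_pos] with x hx hx0
      simp only [hφ, Pi.zero_apply, mul_eq_zero] at hx
      rcases hx with hx | hx
      · rw [ENNReal.ofReal_eq_zero] at hx
        exact absurd hx (not_le.2 (Real.rpow_pos_of_pos hx0 _))
      · rw [ENNReal.rpow_neg, ENNReal.inv_eq_zero] at hx
        exact ENNReal.rpow_ne_top_of_nonneg hq.le ENNReal.ofReal_ne_top hx
    rw [ae_iff] at h3
    simp at h3
    exact admissible_leb.ne_zero a b ha hab h3
  have hσtop : ∀ a b : ℝ, 0 ≤ a → a < b → wdx w (Ioo a b) ≠ 0 → σ a b ≠ ∞ := by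
    intro a b ha hab hne htop
    have h := hC a b ha hab
    rw [htop, ENNReal.mul_top (ENNReal.inv_ne_zero.2 (hμ.ne_top a b ha hab)),
      ENNReal.top_rpow_of_pos hp1, ENNReal.mul_top (mul_ne_zero
        (ENNReal.inv_ne_zero.2 (hμ.ne_top a b ha hab)) hne)] at h
    exact not_top_lt h
  have hwpos : ∀ a b : ℝ, 0 ≤ a → a < b → wdx w (Ioo a b) ≠ 0 →
      ∀ᵐ x ∂(leb.restrict (Ioo a b)), 0 < w x := by
    intro a b ha hab hne
    filter_upwards [ae_lt_top' hφm.restrict (hσtop a b ha hab hne), ae_Ioo_pos] with x hx hx0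
    by_contra! hwx
    refine hx.ne ?_
    simp only [hφ]
    rw [ENNReal.ofReal_of_nonpos hwx, ENNReal.zero_rpow_of_neg (by linarith), ENNReal.mul_top]
    simpa using Real.rpow_pos_of_pos hx0 _
  have hadm : Admissible (wdx w) := by
    refine admissible_wdx hwm hw0 (fun a b ha hab htop => ?_) hwpos
    have h := hC a b ha hab
    rw [htop, ENNReal.mul_top (ENNReal.inv_ne_zero.2 (hμ.ne_top a b ha hab)),
      ENNReal.top_mul] at h
    · exact not_top_lt h
    · simp only [Ne, ENNReal.rpow_eq_zero_iff, not_or, not_and, mul_eq_zero]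
      refine ⟨fun h => absurd h ?_, fun _ => not_lt.2 hp1.le⟩
      rw [not_or]
      exact ⟨ENNReal.inv_ne_zero.2 (hμ.ne_top a b ha hab), hσ0 a b ha hab⟩
  have hC0 : 0 < (C : ℝ) := by
    have := (zero_le (a := _)).trans_lt (hC 0 1 le_rfl one_pos)
    exact_mod_cast this
  refine ⟨hadm, (1 / 2) ^ p / C, by positivity, fun a b ha hab E hE hEB hhalf => ?_⟩
  have hne := hadm.ne_zero a b ha hab
  have hpq : p.HolderConjugate (p / (p - 1)) := Real.HolderConjugate.conjExponent hp
  -- Hölder's inequality for `x ^ (2 lam) = w ^ (1 / p) * (x ^ (2 lam) * w ^ (-1 / p))` on `E`.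
  have hHol : besselMu lam E ≤ wdx w E ^ (1 / p) * σ a b ^ (1 / (p / (p - 1))) := by
    have hb : AEMeasurable (fun x : ℝ => ENNReal.ofReal (x ^ (2 * lam)) *
        ENNReal.ofReal (w x) ^ (-(1 / p))) leb :=
      ((Measurable.pow_const measurable_id _).ennreal_ofReal.aemeasurable).mul
        (hwm.1.ennreal_ofReal.pow_const _)
    have h := ENNReal.lintegral_mul_le_Lp_mul_Lq (leb.restrict E) hpq
      (hwm.1.ennreal_ofReal.pow_const (1 / p)).restrict hb.restrict
    have hl : besselMu lam E = ∫⁻ x in E, ((fun x => ENNReal.ofReal (w x) ^ (1 / p)) *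
        fun x : ℝ => ENNReal.ofReal (x ^ (2 * lam)) *
          ENNReal.ofReal (w x) ^ (-(1 / p))) x ∂leb := by
      rw [besselMu, wdx_apply _ hE]
      refine lintegral_congr_ae ?_
      filter_upwards [ae_restrict_of_ae_restrict_of_subset hEB (hwpos a b ha hab hne)] with x hx
      have hx' : ENNReal.ofReal (w x) ≠ 0 := by simpa using hx
      simp only [Pi.mul_apply]
      rw [mul_left_comm, ← ENNReal.rpow_add _ _ hx' ENNReal.ofReal_ne_top]
      simp
    rw [hl]
    refine h.trans ?_
    have e1 : ∫⁻ x in E, (ENNReal.ofReal (w x) ^ (1 / p)) ^ p ∂leb = wdx w E := by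
      rw [wdx_apply _ hE]
      refine lintegral_congr fun x => ?_
      rw [← ENNReal.rpow_mul, one_div_mul_cancel hp0.ne', ENNReal.rpow_one]
    have e2 : ∫⁻ x in E, (ENNReal.ofReal (x ^ (2 * lam)) *
        ENNReal.ofReal (w x) ^ (-(1 / p))) ^ (p / (p - 1)) ∂leb ≤ σ a b := by
      refine le_trans ?_ (lintegral_mono_set hEB)
      refine lintegral_mono_ae ?_
      filter_upwards [ae_restrict_of_ae (s := E) ae_leb_pos] with x hx0
      rw [ENNReal.mul_rpow_of_nonneg _ _ (by positivity), ← ENNReal.rpow_mul,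
        ENNReal.ofReal_rpow_of_nonneg (by positivity) (by positivity), ← Real.rpow_mul hx0.le]
      simp only [hφ]
      have : -(1 / p) * (p / (p - 1)) = -(1 / (p - 1)) := by field_simp
      rw [this]
    rw [e1]
    gcongr
  have hHol' : (besselMu lam).real E ^ p ≤ (wdx w).real E * (σ a b).toReal ^ (p - 1) := by
    have h1 := ENNReal.rpow_le_rpow hHol hp0.le
    rw [ENNReal.mul_rpow_of_nonneg _ _ hp0.le, ← ENNReal.rpow_mul, ← ENNReal.rpow_mul,
      one_div_mul_cancel hp0.ne', ENNReal.rpow_one,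
      show 1 / (p / (p - 1)) * p = p - 1 by field_simp] at h1
    have h2 := ENNReal.toReal_mono (ENNReal.mul_ne_top (hadm.measure_ne_top hEB)
      (ENNReal.rpow_ne_top_of_nonneg hp1.le (hσtop a b ha hab hne))) h1
    rwa [ENNReal.toReal_mul, ← ENNReal.toReal_rpow, ← ENNReal.toReal_rpow] at h2
  have hC' : ((besselMu lam).real (Ioo a b))⁻¹ * (wdx w).real (Ioo a b) *
      (((besselMu lam).real (Ioo a b))⁻¹ * (σ a b).toReal) ^ (p - 1) ≤ C := by
    have h := ENNReal.toReal_mono ENNReal.coe_ne_top (hC a b ha hab).le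
    rwa [ENNReal.toReal_mul, ENNReal.toReal_mul, ← ENNReal.toReal_rpow, ENNReal.toReal_mul,
      ENNReal.toReal_inv] at h
  have hM := hμ.real_pos ha hab
  set M := (besselMu lam).real (Ioo a b) with hM_def
  set k := (wdx w).real (Ioo a b) with hk_def
  have hk : 0 ≤ k := measureReal_nonneg
  set e := (wdx w).real E with he_def
  have he0 : 0 ≤ e := measureReal_nonneg
  set S := (σ a b).toReal with hS_def
  have hS : 0 ≤ S := ENNReal.toReal_nonneg
  have hMp : M ^ p = M * M ^ (p - 1) := by
    nth_rewrite 2 [← Real.rpow_one M]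
    rw [← Real.rpow_add hM]; congr 1; ring
  have h1 : k * S ^ (p - 1) ≤ C * M ^ p := by
    rw [Real.mul_rpow (by positivity) hS, Real.inv_rpow hM.le] at hC'
    have := mul_le_mul_of_nonneg_right hC' (show 0 ≤ M * M ^ (p - 1) by positivity)
    rw [hMp]
    refine le_trans (le_of_eq ?_) this
    have : M ^ (p - 1) ≠ 0 := by positivity
    field_simp
  have h2 : (1 / 2 * M) ^ p ≤ e * S ^ (p - 1) := le_trans (by gcongr) hHol'
  rw [Real.mul_rpow (by norm_num) hM.le] at h2
  have hMp0 : 0 < M ^ p := by positivity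
  have h3 : (1 / 2) ^ p * k * M ^ p ≤ C * e * M ^ p :=
    calc (1 / 2) ^ p * k * M ^ p = k * ((1 / 2) ^ p * M ^ p) := by ring
      _ ≤ k * (e * S ^ (p - 1)) := by gcongr
      _ = e * (k * S ^ (p - 1)) := by ring
      _ ≤ e * (C * M ^ p) := by gcongr
      _ = _ := by ring
  have h4 := le_of_mul_le_mul_right h3 hMp0
  rw [div_mul_eq_mul_div, div_le_iff₀ hC0]
  linarith

theorem MemTildeAInfty.admissible_and_halfComparable {lam : ℝ} (hlam : 0 < lam) {w : ℝ → ℝ}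
    (hw : MemTildeAInfty (lam - 1 / 2) w) (hw0 : ¬ (∀ᵐ x ∂leb, w x = 0)) :
    Admissible (wdx w) ∧ HalfComparable (wdx w) (besselMu lam) := by
  rcases hw with hw | ⟨p, hp, hw⟩
  · exact hw.admissible_and_halfComparable hlam hw0
  · exact hw.admissible_and_halfComparable hlam hp hw0

/-! ### Comparison of the gauges -/

theorem medianGauge_half_le {s : ℝ} (hs : s ≤ 1 / 2) (w f : ℝ → ℝ) :
    medianGauge (1 / 2) w f ≤ medianGauge s w f := by
  refine iSup_mono fun a => iSup_mono fun b => iSup_mono fun _ => iSup_mono fun _ =>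
    iInf_mono fun c => iInf_mono fun t => iInf_const_mono fun h => h.trans_le ?_
  gcongr

theorem medianGaugeLe_le (s : ℝ) (w f : ℝ → ℝ) : medianGaugeLe s w f ≤ medianGauge s w f :=
  iSup_mono fun _ => iSup_mono fun _ => iSup_mono fun _ => iSup_mono fun _ =>
    iInf_mono fun _ => iInf_mono fun _ => iInf_const_mono fun h => h.le

theorem medianGauge_half_le_medianGaugeLe {s : ℝ} (hs : s < 1 / 2) {w : ℝ → ℝ}
    (hw : Admissible (wdx w)) (f : ℝ → ℝ) :
    medianGauge (1 / 2) w f ≤ medianGaugeLe s w f := by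
  refine iSup_mono fun a => iSup_mono fun b => iSup_mono fun ha => iSup_mono fun hab =>
    iInf_mono fun c => iInf_mono fun t => iInf_const_mono fun h => h.trans_lt ?_
  refine (ENNReal.mul_lt_mul_iff_left (hw.ne_zero a b ha hab) (hw.ne_top a b ha hab)).2 ?_
  exact (ENNReal.ofReal_lt_ofReal_iff (by norm_num)).2 hs

theorem medianBounded_of_medianGauge_lt {w : ℝ → ℝ} (hw : Admissible (wdx w)) {f : ℝ → ℝ} {A : ℝ}
    (h : medianGauge (1 / 2) w f < ENNReal.ofReal A) : MedianBounded (wdx w) f A := by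
  intro a b ha hab
  have h1 := (le_iSup₂_of_le a b (le_iSup₂_of_le ha hab le_rfl)).trans_lt h
  simp only [iInf_lt_iff] at h1
  obtain ⟨c, t, hct, htA⟩ := h1
  have htA' : (t : ℝ) ≤ A := by
    rw [← ENNReal.ofReal_coe_nnreal, ENNReal.ofReal_lt_ofReal_iff'] at htA
    exact htA.1.le
  refine ⟨c, (hw.real_sep_mono a b fun x hx => htA'.trans_lt hx).trans_lt ?_⟩
  have h2 := (ENNReal.toReal_lt_toReal (hw.measure_ne_top fun x hx => hx.1)
    (ENNReal.mul_ne_top ENNReal.ofReal_ne_top (hw.ne_top a b ha hab))).2 hct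
  rwa [ENNReal.toReal_mul, ENNReal.toReal_ofReal (by norm_num)] at h2

theorem MedianBounded.medianGauge_le {w : ℝ → ℝ} (hw : Admissible (wdx w)) {f : ℝ → ℝ} {A : ℝ}
    (hA : 0 ≤ A) (h : MedianBounded (wdx w) f A) :
    medianGauge (1 / 2) w f ≤ ENNReal.ofReal A := by
  refine iSup₂_le fun a b => iSup₂_le fun ha hab => ?_
  obtain ⟨c, hc⟩ := h a b ha hab
  refine iInf₂_le_of_le c ⟨A, hA⟩ (iInf_le_of_le ?_ ?_)
  · rw [← ENNReal.toReal_lt_toReal (hw.measure_ne_top fun x hx => hx.1)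
      (ENNReal.mul_ne_top ENNReal.ofReal_ne_top (hw.ne_top a b ha hab)), ENNReal.toReal_mul,
      ENNReal.toReal_ofReal (by norm_num)]
    exact hc
  · exact (ENNReal.ofReal_eq_coe_nnreal hA).ge

/-- A bound which is linear in every `A` with `MedianBounded (wdx w) f A` is linear in the
gauge. The constant `C + 1` is nonzero, so that the bound also holds when the gauge is infinite. -/
theorem le_mul_medianGauge {w : ℝ → ℝ} (hw : Admissible (wdx w)) {f : ℝ → ℝ} {Φ : ℝ≥0∞} {C : ℝ≥0}
    (h : ∀ A : ℝ, 0 < A → MedianBounded (wdx w) f A → Φ ≤ C * ENNReal.ofReal A) :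
    Φ ≤ (C + 1 : ℝ≥0) * medianGauge (1 / 2) w f := by
  have hC0 : ((C + 1 : ℝ≥0) : ℝ≥0∞) ≠ 0 := by simp
  rw [mul_comm, ← ENNReal.div_le_iff_le_mul (Or.inl hC0) (Or.inl ENNReal.coe_ne_top)]
  refine le_of_forall_gt_imp_ge_of_dense fun y hy => ?_
  obtain ⟨A, hA1, hA2⟩ := ENNReal.lt_iff_exists_nnreal_btwn.1 hy
  have hA0 : 0 < A := by exact_mod_cast (zero_le (a := _)).trans_lt hA1
  rw [← ENNReal.ofReal_coe_nnreal] at hA1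
  refine le_trans ?_ hA2.le
  rw [ENNReal.div_le_iff_le_mul (Or.inl hC0) (Or.inl ENNReal.coe_ne_top), mul_comm]
  refine (h A (by exact_mod_cast hA0) (medianBounded_of_medianGauge_lt hw hA1)).trans ?_
  rw [ENNReal.ofReal_coe_nnreal]
  gcongr
  simp

/-- Chebyshev's inequality. -/
theorem medianGauge_le_mul_meanOscGauge {w : ℝ → ℝ} (hw : Admissible (wdx w)) (m : Measure ℝ)
    {f : ℝ → ℝ} (hf : Measurable f) {s p : ℝ} (hs : 0 < s) (hs1 : s ≤ 1) (hp : 1 ≤ p) :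
    medianGauge s w f ≤ (Real.toNNReal (1 / s) : ℝ≥0) * meanOscGauge m (wdx w) p f := by
  refine iSup₂_le fun a b => iSup₂_le fun ha hab => ?_
  set c := ⨍ y in Ioo a b, f y ∂m with hc
  set G := meanOscGauge m (wdx w) p f with hG
  have hp0 : 0 < p := by linarith
  have hB0 := hw.ne_zero a b ha hab
  have hBt := hw.ne_top a b ha hab
  have hGB : ∫⁻ t in Ioo a b, ‖f t - c‖ₑ ^ p ∂(wdx w) ≤ G ^ p * wdx w (Ioo a b) := by
    have h1 : ((wdx w (Ioo a b))⁻¹ * ∫⁻ t in Ioo a b, ‖f t - c‖ₑ ^ p ∂(wdx w)) ^ (1 / p) ≤ G :=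
      le_iSup₂_of_le a b (le_iSup₂_of_le ha hab le_rfl)
    rw [one_div, ENNReal.rpow_inv_le_iff hp0, mul_comm, ← div_eq_mul_inv,
      ENNReal.div_le_iff hB0 hBt] at h1
    exact h1
  refine le_of_forall_gt_imp_ge_of_dense fun y hy => ?_
  obtain ⟨t, ht1, ht2⟩ := ENNReal.lt_iff_exists_nnreal_btwn.1 hy
  refine le_trans (iInf₂_le_of_le c t (iInf_le_of_le ?_ le_rfl)) ht2.le
  by_contra! hcon
  set σ : ℝ≥0∞ := ENNReal.ofReal s with hσ
  have hσ0 : σ ≠ 0 := by simpa [hσ] using hs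
  have hσ1 : σ ≤ 1 := by simpa [hσ] using hs1
  have hGt : G < σ * t := by
    have h1 : ((Real.toNNReal (1 / s) : ℝ≥0) : ℝ≥0∞) = σ⁻¹ := by
      rw [hσ, ← ENNReal.ofReal_inv_of_pos hs, one_div]; rfl
    rw [h1, mul_comm, ← div_eq_mul_inv,
      ENNReal.div_lt_iff (Or.inl hσ0) (Or.inl ENNReal.ofReal_ne_top), mul_comm] at ht1
    exact ht1
  have hmarkov : (t : ℝ≥0∞) ^ p * wdx w {x | x ∈ Ioo a b ∧ (t : ℝ) < |f x - c|} ≤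
      ∫⁻ x in Ioo a b, ‖f x - c‖ₑ ^ p ∂(wdx w) := by
    refine le_trans ?_ (mul_meas_ge_le_lintegral (by fun_prop) ((t : ℝ≥0∞) ^ p))
    gcongr _ * ?_
    refine le_trans (measure_mono ?_) (Measure.le_restrict_apply _ _)
    rintro x ⟨hx, hx'⟩
    refine ⟨?_, hx⟩
    change (t : ℝ≥0∞) ^ p ≤ ‖f x - c‖ₑ ^ p
    gcongr
    rw [Real.enorm_eq_ofReal_abs, ← ENNReal.ofReal_coe_nnreal]
    exact ENNReal.ofReal_le_ofReal hx'.le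
  have h1 : σ * (t : ℝ≥0∞) ^ p * wdx w (Ioo a b) < σ * (t : ℝ≥0∞) ^ p * wdx w (Ioo a b) := by
    calc σ * (t : ℝ≥0∞) ^ p * wdx w (Ioo a b)
        = (t : ℝ≥0∞) ^ p * (σ * wdx w (Ioo a b)) := by ring
      _ ≤ _ := by gcongr
      _ ≤ G ^ p * wdx w (Ioo a b) := hmarkov.trans hGB
      _ < (σ * t) ^ p * wdx w (Ioo a b) :=
          (ENNReal.mul_lt_mul_iff_left hB0 hBt).2 (ENNReal.rpow_lt_rpow hGt hp0)
      _ = σ ^ p * (t : ℝ≥0∞) ^ p * wdx w (Ioo a b) := by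
          rw [ENNReal.mul_rpow_of_nonneg _ _ hp0.le]
      _ ≤ σ * (t : ℝ≥0∞) ^ p * wdx w (Ioo a b) := by
          gcongr
          exact (ENNReal.rpow_le_rpow_of_exponent_ge hσ1 hp).trans_eq (ENNReal.rpow_one σ)
  exact lt_irrefl _ h1

theorem integrableOn_of_lintegral_enorm_sub {m : Measure ℝ} (hm : Admissible m) {f : ℝ → ℝ}
    (hf : Measurable f) {a b c : ℝ} (h : ∫⁻ x in Ioo a b, ‖f x - c‖ₑ ∂m ≠ ∞) :
    IntegrableOn f (Ioo a b) m := by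
  have h1 : IntegrableOn (fun x => f x - c) (Ioo a b) m :=
    ⟨(hf.sub_const c).aestronglyMeasurable, h.lt_top⟩
  have h2 := h1.add (integrableOn_const (C := c) (hm.measure_Ioo_ne_top a b) (by simp))
  refine h2.congr (Filter.Eventually.of_forall fun x => ?_)
  simp

theorem enorm_setAverage_sub_le {m : Measure ℝ} (hm : Admissible m) {f : ℝ → ℝ} {a b c : ℝ}
    (ha : 0 ≤ a) (hab : a < b) (hf : IntegrableOn f (Ioo a b) m) {Y : ℝ≥0∞}
    (h : ∫⁻ x in Ioo a b, ‖f x - c‖ₑ ∂m ≤ Y * m (Ioo a b)) :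
    ‖(⨍ y in Ioo a b, f y ∂m) - c‖ₑ ≤ Y := by
  have hpos := hm.real_pos ha hab
  have h1 : (⨍ y in Ioo a b, f y ∂m) - c = (m.real (Ioo a b))⁻¹ * ∫ y in Ioo a b, (f y - c) ∂m := by
    rw [setAverage_eq, integral_sub hf (integrableOn_const (hm.measure_Ioo_ne_top a b) (by simp)),
      setIntegral_const, smul_eq_mul, smul_eq_mul]
    field_simp
  rw [h1, enorm_mul, enorm_inv hpos.ne', Real.enorm_of_nonneg hpos.le,
    ofReal_measureReal (hm.measure_Ioo_ne_top a b), mul_comm, ← div_eq_mul_inv,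
    ENNReal.div_le_iff (hm.ne_zero a b ha hab) (hm.ne_top a b ha hab)]
  exact (enorm_integral_le_lintegral_enorm _).trans h

/-- Mean oscillations with respect to `κ`, with averages with respect to `m`, are controlled by the
median bound with respect to `κ`. -/
theorem HalfComparable.exists_meanOscGauge_le {κ m : Measure ℝ} (hκ : Admissible κ)
    (hm : Admissible m) (h : HalfComparable κ m) {p : ℝ} (hp : 1 ≤ p) :
    ∃ C : ℝ≥0, ∀ f : ℝ → ℝ, Measurable f → ∀ A : ℝ, 0 < A → MedianBounded κ f A →
      (∀ a b : ℝ, 0 ≤ a → a < b → IntegrableOn f (Ioo a b) κ ∧ IntegrableOn f (Ioo a b) m) ∧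
      meanOscGauge m κ p f ≤ C * ENNReal.ofReal A := by
  have hp0 : 0 < p := by linarith
  obtain ⟨K, hK, hKt⟩ := h.exists_transfer hκ
  obtain ⟨Cp, hCp⟩ := exists_lintegral_rpow_le hp0.le
  obtain ⟨C₁, hC₁⟩ := exists_lintegral_rpow_le zero_le_one
  simp only [ENNReal.rpow_one] at hC₁
  set D : ℝ≥0∞ := 2 ^ (p - 1) * (Cp + (C₁ * ENNReal.ofReal K) ^ p) with hD
  have hDtop : D ≠ ∞ := by
    refine ENNReal.mul_ne_top (ENNReal.rpow_ne_top_of_nonneg (by linarith) (by simp)) ?_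
    exact ENNReal.add_ne_top.2 ⟨ENNReal.coe_ne_top, ENNReal.rpow_ne_top_of_nonneg hp0.le
      (ENNReal.mul_ne_top ENNReal.coe_ne_top ENNReal.ofReal_ne_top)⟩
  have hDp : D ^ (1 / p) ≠ ∞ := ENNReal.rpow_ne_top_of_nonneg (by positivity) hDtop
  refine ⟨(D ^ (1 / p)).toNNReal, fun f hf A hA hmed => ?_⟩
  have hKA : 0 < K * A := by positivity
  have hmedm : MedianBounded m f (K * A) := fun a b ha hab =>
    let ⟨c, hc⟩ := hKt f hf A hA.le hmed a b ha hab; ⟨c, hc.2⟩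
  have hint : ∀ a b : ℝ, 0 ≤ a → a < b →
      IntegrableOn f (Ioo a b) κ ∧ IntegrableOn f (Ioo a b) m := by
    intro a b ha hab
    obtain ⟨c, hcκ, hcm⟩ := hKt f hf A hA.le hmed a b ha hab
    constructor
    · exact integrableOn_of_lintegral_enorm_sub hκ hf (ne_top_of_le_ne_top
        (ENNReal.mul_ne_top (ENNReal.mul_ne_top ENNReal.coe_ne_top ENNReal.ofReal_ne_top)
          (hκ.ne_top a b ha hab)) (hC₁ κ hκ f hf A A hA.le le_rfl hA hmed a b c ha hcκ.le))
    · exact integrableOn_of_lintegral_enorm_sub hm hf (ne_top_of_le_ne_top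
        (ENNReal.mul_ne_top (ENNReal.mul_ne_top ENNReal.coe_ne_top ENNReal.ofReal_ne_top)
          (hm.ne_top a b ha hab)) (hC₁ m hm f hf _ _ hKA.le le_rfl hKA hmedm a b c ha hcm.le))
  refine ⟨hint, iSup₂_le fun a b => iSup₂_le fun ha hab => ?_⟩
  obtain ⟨c, hcκ, hcm⟩ := hKt f hf A hA.le hmed a b ha hab
  have h1 := hCp κ hκ f hf A A hA.le le_rfl hA hmed a b c ha hcκ.le
  have h2 := enorm_setAverage_sub_le hm ha hab (hint a b ha hab).2
    (hC₁ m hm f hf _ _ hKA.le le_rfl hKA hmedm a b c ha hcm.le)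
  set g := ⨍ y in Ioo a b, f y ∂m with hg
  have hB0 := hκ.ne_zero a b ha hab
  have hBt := hκ.ne_top a b ha hab
  have h3 : ∫⁻ t in Ioo a b, ‖f t - g‖ₑ ^ p ∂κ ≤ D * ENNReal.ofReal A ^ p * κ (Ioo a b) := by
    calc ∫⁻ t in Ioo a b, ‖f t - g‖ₑ ^ p ∂κ
        ≤ ∫⁻ t in Ioo a b, 2 ^ (p - 1) * (‖f t - c‖ₑ ^ p + ‖g - c‖ₑ ^ p) ∂κ := by
          refine lintegral_mono fun t => ?_
          refine le_trans ?_ (ENNReal.rpow_add_le_mul_rpow_add_rpow _ _ hp)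
          gcongr
          rw [show f t - g = (f t - c) - (g - c) by ring]
          exact enorm_sub_le
      _ = 2 ^ (p - 1) * (∫⁻ t in Ioo a b, ‖f t - c‖ₑ ^ p ∂κ + ‖g - c‖ₑ ^ p * κ (Ioo a b)) := by
          rw [lintegral_const_mul' _ _ (ENNReal.rpow_ne_top_of_nonneg (by linarith) (by simp)),
            lintegral_add_right _ measurable_const, setLIntegral_const]
      _ ≤ 2 ^ (p - 1) * (Cp * ENNReal.ofReal A ^ p * κ (Ioo a b) +
            (C₁ * ENNReal.ofReal (K * A)) ^ p * κ (Ioo a b)) := by gcongr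
      _ = D * ENNReal.ofReal A ^ p * κ (Ioo a b) := by
          rw [ENNReal.ofReal_mul (by linarith), ← mul_assoc,
            ENNReal.mul_rpow_of_nonneg _ (ENNReal.ofReal A) hp0.le, hD]
          ring
  rw [ENNReal.coe_toNNReal hDp, one_div, ENNReal.rpow_inv_le_iff hp0, mul_comm, ← div_eq_mul_inv,
    ENNReal.div_le_iff hB0 hBt, ENNReal.mul_rpow_of_nonneg _ _ hp0.le, ← ENNReal.rpow_mul,
    inv_mul_cancel₀ hp0.ne', ENNReal.rpow_one]
  exact h3

theorem HalfComparable.refl (κ : Measure ℝ) : HalfComparable κ κ :=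
  ⟨1 / 2, by norm_num, fun _ _ _ _ _ _ _ h => h⟩

theorem exists_medianGauge_le_mul_half {w : ℝ → ℝ} (hw : Admissible (wdx w)) {s : ℝ} (hs : 0 < s)
    (hs1 : s ≤ 1) : ∃ C : ℝ≥0, ∀ f : ℝ → ℝ, Measurable f →
      medianGauge s w f ≤ C * medianGauge (1 / 2) w f := by
  obtain ⟨C, hC⟩ := (HalfComparable.refl (wdx w)).exists_meanOscGauge_le hw hw le_rfl
  refine ⟨Real.toNNReal (1 / s) * (C + 1), fun f hf => ?_⟩
  refine (medianGauge_le_mul_meanOscGauge hw (wdx w) hf hs hs1 le_rfl).trans ?_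
  rw [ENNReal.coe_mul, mul_assoc]
  gcongr
  exact le_mul_medianGauge hw fun A hA hmed => (hC f hf A hA hmed).2

theorem HalfComparable.exists_medianGauge_le {v w : ℝ → ℝ} (hv : Admissible (wdx v))
    (hw : Admissible (wdx w)) (h : HalfComparable (wdx v) (wdx w)) :
    ∃ C : ℝ≥0, ∀ f : ℝ → ℝ, Measurable f →
      medianGauge (1 / 2) w f ≤ C * medianGauge (1 / 2) v f := by
  obtain ⟨K, hK, hKm⟩ := h.exists_medianBounded hv
  refine ⟨Real.toNNReal K + 1, fun f hf => le_mul_medianGauge hv fun A hA hmed => ?_⟩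
  refine ((hKm f hf A hA.le hmed).medianGauge_le hw (by positivity)).trans_eq ?_
  rw [ENNReal.ofReal_mul (by linarith)]
  rfl

/-! ### Modification on null sets -/

theorem wdx_sep_congr_ae {f g : ℝ → ℝ} (h : f =ᵐ[leb] g) (w : ℝ → ℝ) (a b c t : ℝ) :
    wdx w {x | x ∈ Ioo a b ∧ t < |f x - c|} = wdx w {x | x ∈ Ioo a b ∧ t < |g x - c|} := by
  refine measure_congr ?_
  filter_upwards [(wdx_absolutelyContinuous w).ae_le h] with x hx
  change (x ∈ Ioo a b ∧ t < |f x - c|) = (x ∈ Ioo a b ∧ t < |g x - c|)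
  rw [hx]

theorem medianGauge_congr_ae {f g : ℝ → ℝ} (h : f =ᵐ[leb] g) (s : ℝ) (w : ℝ → ℝ) :
    medianGauge s w f = medianGauge s w g := by
  simp only [medianGauge, wdx_sep_congr_ae h w]

theorem meanOscGauge_congr_ae {m κ : Measure ℝ} (hm : m ≪ leb) (hκ : κ ≪ leb) {f g : ℝ → ℝ}
    (h : f =ᵐ[leb] g) (p : ℝ) : meanOscGauge m κ p f = meanOscGauge m κ p g := by
  have h1 : ∀ a b : ℝ, ⨍ y in Ioo a b, f y ∂m = ⨍ y in Ioo a b, g y ∂m := fun a b =>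
    average_congr (ae_restrict_of_ae (hm.ae_le h))
  have h2 : ∀ a b c : ℝ,
      ∫⁻ t in Ioo a b, ‖f t - c‖ₑ ^ p ∂κ = ∫⁻ t in Ioo a b, ‖g t - c‖ₑ ^ p ∂κ := by
    intro a b c
    refine lintegral_congr_ae ?_
    filter_upwards [ae_restrict_of_ae (hκ.ae_le h)] with x hx
    rw [hx]
  simp only [meanOscGauge, h1, h2]

/-! ### Equivalence of the spaces -/

/-- `X` consists of the measurable functions whose median gauge with respect to the weight `v`, at
level `1 / 2`, is finite, and its gauge is comparable to that one. -/
def GaugeSpace.ComparableToMedian (X : GaugeSpace) (v : ℝ → ℝ) : Prop :=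
  (∀ f, f ∈ X.carrier ↔ AEMeasurable f leb ∧ medianGauge (1 / 2) v f < ∞) ∧
  ∃ C : ℝ≥0, ∀ f, AEMeasurable f leb →
    X.gauge f ≤ C * medianGauge (1 / 2) v f ∧ medianGauge (1 / 2) v f ≤ C * X.gauge f

theorem GaugeSpace.ComparableToMedian.equivalent {X Y : GaugeSpace} {v : ℝ → ℝ}
    (hX : X.ComparableToMedian v) (hY : Y.ComparableToMedian v) : X.Equivalent Y := by
  obtain ⟨hX1, C, hC⟩ := hX
  obtain ⟨hY1, D, hD⟩ := hY
  refine ⟨Set.ext fun f => (hX1 f).trans (hY1 f).symm, C * D, fun f hf => ?_⟩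
  have hfm := ((hX1 f).1 hf).1
  obtain ⟨h1, h2⟩ := hC f hfm
  obtain ⟨h3, h4⟩ := hD f hfm
  constructor
  · rw [ENNReal.coe_mul, mul_assoc]
    exact h1.trans (by gcongr)
  · rw [ENNReal.coe_mul, mul_comm (C : ℝ≥0∞), mul_assoc]
    exact h3.trans (by gcongr)

/-- A space of measurable functions with finite gauge is comparable to the median space of `v` as
soon as its gauge is equivalent to the median gauge of a comparable weight `w`. -/
theorem comparableToMedian_of_gauge {X : GaugeSpace} {v w : ℝ → ℝ} (hv : Admissible (wdx v))
    (hw : Admissible (wdx w)) (hvw : HalfComparable (wdx v) (wdx w))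
    (hwv : HalfComparable (wdx w) (wdx v))
    (hcar : ∀ f, f ∈ X.carrier ↔ AEMeasurable f leb ∧ X.gauge f < ∞)
    (hle : ∃ C : ℝ≥0, ∀ f, AEMeasurable f leb → X.gauge f ≤ C * medianGauge (1 / 2) w f)
    (hge : ∃ C : ℝ≥0, ∀ f, AEMeasurable f leb → medianGauge (1 / 2) w f ≤ C * X.gauge f) :
    X.ComparableToMedian v := by
  obtain ⟨C, hC⟩ := hle
  obtain ⟨D, hD⟩ := hge
  obtain ⟨K, hK⟩ := hvw.exists_medianGauge_le hv hw
  obtain ⟨L, hL⟩ := hwv.exists_medianGauge_le hw hv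
  have h1 : ∀ f, AEMeasurable f leb → X.gauge f ≤ (C * K : ℝ≥0) * medianGauge (1 / 2) v f := by
    intro f hf
    have h := hK _ hf.measurable_mk
    rw [← medianGauge_congr_ae hf.ae_eq_mk, ← medianGauge_congr_ae hf.ae_eq_mk] at h
    rw [ENNReal.coe_mul, mul_assoc]
    exact (hC f hf).trans (by gcongr)
  have h2 : ∀ f, AEMeasurable f leb → medianGauge (1 / 2) v f ≤ (L * D : ℝ≥0) * X.gauge f := by
    intro f hf
    have h := hL _ hf.measurable_mk
    rw [← medianGauge_congr_ae hf.ae_eq_mk, ← medianGauge_congr_ae hf.ae_eq_mk] at h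
    rw [ENNReal.coe_mul, mul_assoc]
    exact h.trans (by gcongr; exact hD f hf)
  refine ⟨fun f => (hcar f).trans (and_congr_right fun hf => ⟨fun h => ?_, fun h => ?_⟩),
    C * K + L * D, fun f hf => ⟨(h1 f hf).trans ?_, (h2 f hf).trans ?_⟩⟩
  · exact (h2 f hf).trans_lt (ENNReal.mul_lt_top ENNReal.coe_lt_top h)
  · exact (h1 f hf).trans_lt (ENNReal.mul_lt_top ENNReal.coe_lt_top h)
  · gcongr; exact le_self_add
  · gcongr; exact le_add_self

theorem exists_medianGauge_le_mul_half_of_aemeasurable {w : ℝ → ℝ} (hw : Admissible (wdx w)) {s : ℝ}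
    (hs : 0 < s) (hs1 : s ≤ 1) : ∃ C : ℝ≥0, ∀ f : ℝ → ℝ, AEMeasurable f leb →
      medianGauge s w f ≤ C * medianGauge (1 / 2) w f := by
  obtain ⟨C, hC⟩ := exists_medianGauge_le_mul_half hw hs hs1
  refine ⟨C, fun f hf => ?_⟩
  rw [medianGauge_congr_ae hf.ae_eq_mk, medianGauge_congr_ae hf.ae_eq_mk]
  exact hC _ hf.measurable_mk

theorem bmoZero_comparableToMedian {v w : ℝ → ℝ} (hv : Admissible (wdx v))
    (hw : Admissible (wdx w)) (hvw : HalfComparable (wdx v) (wdx w))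
    (hwv : HalfComparable (wdx w) (wdx v)) {s : ℝ} (hs : 0 < s)
    (hs' : s ≤ 1 / 2) :
    (bmoZero s w).ComparableToMedian v := by
  refine comparableToMedian_of_gauge hv hw hvw hwv (fun f => Iff.rfl)
    (exists_medianGauge_le_mul_half_of_aemeasurable hw hs (by linarith)) ⟨1, fun f _ => ?_⟩
  rw [ENNReal.coe_one, one_mul]
  exact medianGauge_half_le hs' w f

theorem bmoZeroLe_comparableToMedian {v w : ℝ → ℝ} (hv : Admissible (wdx v))
    (hw : Admissible (wdx w)) (hvw : HalfComparable (wdx v) (wdx w))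
    (hwv : HalfComparable (wdx w) (wdx v)) {s : ℝ} (hs : 0 < s)
    (hs' : s < 1 / 2) :
    (bmoZeroLe s w).ComparableToMedian v := by
  obtain ⟨C, hC⟩ := exists_medianGauge_le_mul_half_of_aemeasurable hw hs (by linarith)
  refine comparableToMedian_of_gauge hv hw hvw hwv (fun f => Iff.rfl)
    ⟨C, fun f hf => (medianGaugeLe_le s w f).trans (hC f hf)⟩ ⟨1, fun f _ => ?_⟩
  rw [ENNReal.coe_one, one_mul]
  exact medianGauge_half_le_medianGaugeLe hs' hw f

theorem meanOscSpace_comparableToMedian {v w : ℝ → ℝ} (hv : Admissible (wdx v))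
    (hw : Admissible (wdx w)) (hvw : HalfComparable (wdx v) (wdx w))
    (hwv : HalfComparable (wdx w) (wdx v)) {m : Measure ℝ} (hm : Admissible m)
    (hwm : HalfComparable (wdx w) m) {p : ℝ} (hp : 1 ≤ p) :
    (meanOscSpace m (wdx w) p).ComparableToMedian v := by
  obtain ⟨C, hC⟩ := hwm.exists_meanOscGauge_le hw hm hp
  have hge : ∀ f, AEMeasurable f leb → medianGauge (1 / 2) w f ≤
      (Real.toNNReal (1 / (1 / 2)) : ℝ≥0) * meanOscGauge m (wdx w) p f := by
    intro f hf
    rw [medianGauge_congr_ae hf.ae_eq_mk, meanOscGauge_congr_ae hm.ac hw.ac hf.ae_eq_mk]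
    exact medianGauge_le_mul_meanOscGauge hw m hf.measurable_mk (by norm_num) (by norm_num) hp
  refine comparableToMedian_of_gauge hv hw hvw hwv (fun f => ⟨fun h => ⟨h.1, h.2.2.2⟩, ?_⟩)
    ⟨C + 1, fun f hf => ?_⟩ ⟨_, hge⟩
  · rintro ⟨hf, hfin⟩
    have hmed : medianGauge (1 / 2) w (hf.mk f) < ∞ := by
      rw [← medianGauge_congr_ae hf.ae_eq_mk]
      exact (hge f hf).trans_lt (ENNReal.mul_lt_top ENNReal.coe_lt_top hfin)
    obtain ⟨A, hA, -⟩ := ENNReal.lt_iff_exists_nnreal_btwn.1 hmed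
    have hA0 : 0 < A := by exact_mod_cast (zero_le (a := _)).trans_lt hA
    rw [← ENNReal.ofReal_coe_nnreal] at hA
    obtain ⟨hint, -⟩ := hC _ hf.measurable_mk A (by exact_mod_cast hA0)
      (medianBounded_of_medianGauge_lt hw hA)
    refine ⟨hf, fun x hx => ⟨Ioo 0 (x + 1), ?_, ?_⟩, fun a b ha hab => ?_, hfin⟩
    · exact mem_nhdsWithin_of_mem_nhds (Ioo_mem_nhds hx (by linarith))
    · have hx : 0 < x := hx
      exact (hint 0 (x + 1) le_rfl (by linarith)).1.congr
        (ae_restrict_of_ae (hw.ac.ae_le hf.ae_eq_mk.symm))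
    · exact (hint a b ha hab).2.congr (ae_restrict_of_ae (hm.ac.ae_le hf.ae_eq_mk.symm))
  · change meanOscGauge m (wdx w) p f ≤ _
    rw [medianGauge_congr_ae hf.ae_eq_mk, meanOscGauge_congr_ae hm.ac hw.ac hf.ae_eq_mk]
    exact le_mul_medianGauge hw fun A hA hmed => (hC _ hf.measurable_mk A hA hmed).2

end BesselBMO

open BesselBMO

theorem mainTheorem7 (lam : ℝ) (hlam : 0 < lam) (w : ℝ → ℝ)
    (hw : BesselBMO.MemTildeAInfty (lam - 1 / 2) w)
    (hw0 : ¬ (∀ᵐ x ∂BesselBMO.leb, w x = 0))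
    (s : ℝ) (hs : 0 < s) (hs' : s ≤ 1 / 2) (p : ℝ) (hp : 1 ≤ p) :
    (BesselBMO.bmoZero s w).Equivalent (BesselBMO.bmoLp lam w p) ∧
    (BesselBMO.bmoLp lam w p).Equivalent (BesselBMO.bmoDelta lam) ∧
    (BesselBMO.bmoDelta lam).Equivalent BesselBMO.bmoClassical ∧
    BesselBMO.bmoClassical.Equivalent (BesselBMO.bmoLpClassical p) ∧
    (BesselBMO.bmoLpClassical p).Equivalent (BesselBMO.bmoLp lam (fun _ => 1) p) ∧
    (BesselBMO.bmoLp lam (fun _ => 1) p).Equivalent (BesselBMO.bmoZero s (fun _ => 1)) ∧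
    (s < 1 / 2 →
      (BesselBMO.bmoZeroLe s w).Equivalent (BesselBMO.bmoZero s w) ∧
      (BesselBMO.bmoZeroLe s (fun _ => 1)).Equivalent (BesselBMO.bmoZero s (fun _ => 1))) := by
  have hμ : Admissible (wdx fun x => x ^ (2 * lam)) := admissible_besselMu hlam
  obtain ⟨hwa, hwμ⟩ := hw.admissible_and_halfComparable hlam hw0
  have hμw : HalfComparable (besselMu lam) (wdx w) :=
    hwμ.symm hwa hμ (hwa.ac.trans (leb_absolutelyContinuous_besselMu lam))
  have h1a : Admissible (wdx fun _ => 1) := by rw [wdx_one]; exact admissible_leb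
  have hμ1 : HalfComparable (besselMu lam) (wdx fun _ => 1) := by
    rw [wdx_one]; exact halfComparable_besselMu_leb hlam
  have h1μ : HalfComparable (wdx fun _ => 1) (besselMu lam) :=
    hμ1.symm hμ h1a (by rw [wdx_one]; exact hμ.ac)
  have hμμ := HalfComparable.refl (besselMu lam)
  have hLp := meanOscSpace_comparableToMedian hμ hwa hμw hwμ hμ hwμ hp
  have hDelta := meanOscSpace_comparableToMedian hμ hμ hμμ hμμ hμ hμμ le_rfl
  have hcl : ∀ q : ℝ, 1 ≤ q → (bmoLpClassical q).ComparableToMedian fun x => x ^ (2 * lam) := by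
    intro q hq
    have := meanOscSpace_comparableToMedian hμ h1a hμ1 h1μ h1a (HalfComparable.refl _) hq
    rwa [wdx_one] at this
  have hLp1 := meanOscSpace_comparableToMedian hμ h1a hμ1 h1μ hμ h1μ hp
  have hZw := bmoZero_comparableToMedian hμ hwa hμw hwμ hs hs'
  have hZ1 := bmoZero_comparableToMedian hμ h1a hμ1 h1μ hs hs'
  exact ⟨hZw.equivalent hLp, hLp.equivalent hDelta, hDelta.equivalent (hcl 1 le_rfl),
    (hcl 1 le_rfl).equivalent (hcl p hp), (hcl p hp).equivalent hLp1, hLp1.equivalent hZ1,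
    fun hs2 => ⟨(bmoZeroLe_comparableToMedian hμ hwa hμw hwμ hs hs2).equivalent hZw,
      (bmoZeroLe_comparableToMedian hμ h1a hμ1 h1μ hs hs2).equivalent hZ1⟩⟩
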